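/- Let $\varphi\in\mathcal S_0(\mathbb R)=\{\varphi\in\mathcal S(\mathbb R):\int x^n\varphi(x)\,dx=0\ \forall n\in\mathbb N_0\}$ be an orthonormal wavelet, i.e. the functions $\varphi_{m,n}(x)=2^{m/2}\varphi(2^mx-n)$, $m,n\in\mathbb Z$, form an orthonormal basis of $L^2(\mathbb R)$. Let $L$ be slowly varying at the origin, i.e. for some $A>0$ the function $L$ is measurable and positive on $(0,A]$, and $\lim_{\varepsilon\to0^+}L(a\varepsilon)/L(\varepsilon)=1$ for each $a>0$. Let $f\in\mathcal S'(\mathbb R)$, $x_0\in\mathbb R$, and $\alpha>0$ with $\alpha\notin\mathbb N$. Put $c_{m,n}(\varepsilon)=\langle f(x_0+\varepsilon\,\cdot\,),\overline{\varphi_{m,n}}\rangle$. For $\varepsilon_0\in(0,A]$ consider the conditions (i) the limit $\lim_{\varepsilon\to0^+}\dfrac{c_{m,n}(\varepsilon)}{\varepsilon^\alpha L(\varepsilon)}\in\mathbb C$ exists for each $m,n\in\mathbb Z$; (ii)$_{\varepsilon_0}$ there exist positive constants $\beta,\gamma,C$ such that $|c_{m,n}(\varepsilon)|\le C\varepsilon^\alpha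 L(\varepsilon)(1+|n|)^\beta\left(2^m+\frac1{2^m}\right)^\gamma$ for all $m,n\in\mathbb Z$ and $0<\varepsilon\le\varepsilon_0$; (iii) there exist a polynomial $p$ (with complex coefficients) of degree less than $\alpha$ and a distribution $g\in\mathcal S'(\mathbb R)$ homogeneous of degree $\alpha$ (i.e. $g(ax)=a^\alpha g(x)$ for each $a>0$) such that $$f(x_0+\varepsilon x)=p(\varepsilon x)+\varepsilon^\alpha L(\varepsilon)g(x)+o(\varepsilon^\alpha L(\varepsilon))\quad\text{as }\varepsilon\to0^+\text{ in }\mathcal S'(\mathbb R),$$ that is, $\langle f(x_0+\varepsilon\,\cdot\,),\psi\rangle=\int p(\varepsilon x)\psi(x)\,dx+\varepsilon^\alpha L(\varepsilon)\langle g,\psi\rangle+o(\varepsilon^\alpha L(\varepsilon))$ for each $\psi\in\mathcal S(\mathbb R)$. Then (iii) holds if and only if (i) holds and (ii)$_{\varepsilon_0}$ holds for some $\varepsilon_0\in(0,A]$. Moreover, for every $\varepsilon_0\in(0,A]$ such that $L$ is bounded away from $0$ on $[\delta,\varepsilon_0]$ for each $0<\delta\le\varepsilon_0$ (e.g. $\varepsilon_0=1$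 when $A\ge1$ and $L$ is continuous on $(0,1]$), (iii) holds if and only if (i) and (ii)$_{\varepsilon_0}$ hold. -/

import Mathlib

open Filter Topology MeasureTheory Asymptotics
open scoped SchwartzMap

noncomputable section

/-- The affine change of variables `ψ ↦ ψ(c x + b)` on `𝓢(ℝ)`, for `c ≠ 0`
(the value for `c = 0` is irrelevant and set to `0`). -/
def affineComp (c b : ℝ) : 𝓢(ℝ, ℂ) →L[ℂ] 𝓢(ℝ, ℂ) :=
  open Classical in
  if hc : c ≠ 0 then
    (SchwartzMap.compCLMOfContinuousLinearEquiv ℂ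
      (ContinuousLinearEquiv.smulLeft (M₁ := ℝ) (R₁ := ℝ) (Units.mk0 c hc))).comp
      (SchwartzMap.compSubConstCLM ℂ (-b))
  else 0

theorem affineComp_apply {c : ℝ} (hc : c ≠ 0) (b : ℝ) (ψ : 𝓢(ℝ, ℂ)) (x : ℝ) :
    affineComp c b ψ x = ψ (c * x + b) := by
  simp [affineComp, hc, Units.smul_def]

/-- The tempered distribution `f(x₀ + ε ·)`, for `ε ≠ 0`, defined by the usual duality formula
`⟨f(x₀ + ε ·), ψ⟩ = |ε|⁻¹ ⟨f, ψ((· - x₀) / ε)⟩`. -/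
def affineDistribution (f : 𝓢'(ℝ, ℂ)) (x₀ ε : ℝ) : 𝓢'(ℝ, ℂ) :=
  ((|ε|⁻¹ : ℝ) : ℂ) • PointwiseConvergenceCLM.precomp ℂ (affineComp ε⁻¹ (-(x₀ / ε))) f

theorem affineDistribution_apply (f : 𝓢'(ℝ, ℂ)) (x₀ ε : ℝ) (ψ : 𝓢(ℝ, ℂ)) :
    affineDistribution f x₀ ε ψ =
      ((|ε|⁻¹ : ℝ) : ℂ) * f (affineComp ε⁻¹ (-(x₀ / ε)) ψ) := rfl

/-- Homogeneity of degree `α`: `g(a x) = a ^ α g(x)` for each `a > 0`. -/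
def IsHomogeneousDistribution (g : 𝓢'(ℝ, ℂ)) (α : ℝ) : Prop :=
  ∀ a : ℝ, 0 < a → affineDistribution g 0 a = ((a ^ α : ℝ) : ℂ) • g

/-- The space `𝓢₀(ℝ)` of Schwartz functions all of whose moments vanish. -/
def schwartzZero : Set 𝓢(ℝ, ℂ) :=
  {φ | ∀ n : ℕ, ∫ x : ℝ, ((x ^ n : ℝ) : ℂ) * φ x = 0}

/-- `φ` is an orthonormal wavelet: the functions `2^{m/2} φ(2^m x - n)`, `m, n ∈ ℤ`, form an
orthonormal (Hilbert) basis of `L²(ℝ)`. -/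
def IsOrthonormalWavelet (φ : ℝ → ℂ) : Prop :=
  ∃ b : HilbertBasis (ℤ × ℤ) ℂ (Lp ℂ 2 (volume : Measure ℝ)),
    ∀ m n : ℤ, (b (m, n) : ℝ → ℂ) =ᵐ[volume]
      fun x : ℝ => (((2 : ℝ) ^ ((m : ℝ) / 2) : ℝ) : ℂ) * φ ((2 : ℝ) ^ m * x - n)

/-- The Schwartz function `φ_{m,n}(x) = 2^{m/2} φ(2^m x - n)`. -/
def waveletFun (φ : 𝓢(ℝ, ℂ)) (m n : ℤ) : 𝓢(ℝ, ℂ) :=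
  (((2 : ℝ) ^ ((m : ℝ) / 2) : ℝ) : ℂ) • affineComp ((2 : ℝ) ^ m) (-(n : ℝ)) φ

theorem waveletFun_apply (φ : 𝓢(ℝ, ℂ)) (m n : ℤ) (x : ℝ) :
    waveletFun φ m n x =
      (((2 : ℝ) ^ ((m : ℝ) / 2) : ℝ) : ℂ) * φ ((2 : ℝ) ^ m * x - n) := by
  have h : (2 : ℝ) ^ m ≠ 0 := by positivity
  simp [waveletFun, affineComp_apply h, sub_eq_add_neg]

/-- The pointwise complex conjugate of a Schwartz function. -/
def schwartzConj (ψ : 𝓢(ℝ, ℂ)) : 𝓢(ℝ, ℂ) :=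
  ψ.postcompCLM (𝕜 := ℝ) (Complex.conjCLE : ℂ →L[ℝ] ℂ)

theorem schwartzConj_apply (ψ : 𝓢(ℝ, ℂ)) (x : ℝ) :
    schwartzConj ψ x = (starRingEnd ℂ) (ψ x) := rfl

/-- The wavelet coefficients `c_{m,n}(f; ε, x₀) = ⟨f(x₀ + ε ·), conj φ_{m,n}⟩`. -/
def waveletCoeff (φ : 𝓢(ℝ, ℂ)) (f : 𝓢'(ℝ, ℂ)) (x₀ : ℝ) (m n : ℤ) (ε : ℝ) : ℂ :=
  affineDistribution f x₀ ε (schwartzConj (waveletFun φ m n))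

/-- `L` is defined, measurable and positive on `(0, A]`, and slowly varying at the origin.
(The values of `L` off `(0, A]` play no role.) -/
structure IsSlowlyVaryingAtZero (L : ℝ → ℝ) (A : ℝ) : Prop where
  A_pos : 0 < A
  measurable : Measurable ((Set.Ioc 0 A).domRestrict L)
  pos : ∀ ε ∈ Set.Ioc 0 A, 0 < L ε
  ratio : ∀ a : ℝ, 0 < a → Tendsto (fun ε => L (a * ε) / L ε) (𝓝[>] 0) (𝓝 1)

/-- The limits of `c_{m,n}(f; ε, x₀) / (ε ^ α L(ε))` as `ε → 0⁺` exist (and are finite). -/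
def CoeffLimitsExist (φ : 𝓢(ℝ, ℂ)) (f : 𝓢'(ℝ, ℂ)) (x₀ α : ℝ) (L : ℝ → ℝ) : Prop :=
  ∀ m n : ℤ, ∃ l : ℂ,
    Tendsto (fun ε : ℝ => waveletCoeff φ f x₀ m n ε / ((ε ^ α * L ε : ℝ) : ℂ)) (𝓝[>] 0) (𝓝 l)

/-- The bound `|c_{m,n}(f; ε, x₀)| ≤ C ε ^ α L(ε) (1 + |n|) ^ β (2 ^ m + 2 ^ (-m)) ^ γ`
for all `m, n ∈ ℤ` and `0 < ε ≤ ε₀`. -/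
def CoeffBound (φ : 𝓢(ℝ, ℂ)) (f : 𝓢'(ℝ, ℂ)) (x₀ α : ℝ) (L : ℝ → ℝ) (ε₀ : ℝ) : Prop :=
  ∃ β γ C : ℝ, 0 < β ∧ 0 < γ ∧ 0 < C ∧
    ∀ m n : ℤ, ∀ ε : ℝ, 0 < ε → ε ≤ ε₀ →
      ‖waveletCoeff φ f x₀ m n ε‖ ≤
        C * (ε ^ α * L ε) * (1 + |(n : ℝ)|) ^ β * ((2 : ℝ) ^ m + 1 / (2 : ℝ) ^ m) ^ γ

/-- `f(x₀ + ε x) = p(ε x) + ε ^ α L(ε) g(x) + o(ε ^ α L(ε))` as `ε → 0⁺` in `𝓢'(ℝ)`,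
that is, after pairing with each test function in `𝓢(ℝ)`. -/
def HasExpansion (f : 𝓢'(ℝ, ℂ)) (x₀ α : ℝ) (L : ℝ → ℝ) (p : Polynomial ℂ) (g : 𝓢'(ℝ, ℂ)) :
    Prop :=
  ∀ ψ : 𝓢(ℝ, ℂ),
    (fun ε : ℝ => affineDistribution f x₀ ε ψ - (∫ x : ℝ, p.eval ((ε * x : ℝ) : ℂ) * ψ x)
        - ((ε ^ α * L ε : ℝ) : ℂ) * g ψ)
      =o[𝓝[>] 0] fun ε : ℝ => ε ^ α * L ε

/-- Existence of a polynomial `p` of degree less than `α` and of a distribution `g` homogeneous of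
degree `α` with `f(x₀ + ε x) = p(ε x) + ε ^ α L(ε) g(x) + o(ε ^ α L(ε))` in `𝓢'(ℝ)`. -/
def ExpansionExists (f : 𝓢'(ℝ, ℂ)) (x₀ α : ℝ) (L : ℝ → ℝ) : Prop :=
  ∃ (p : Polynomial ℂ) (g : 𝓢'(ℝ, ℂ)), (p.natDegree : ℝ) < α ∧
    IsHomogeneousDistribution g α ∧ HasExpansion f x₀ α L p g

end

/-! Write T_ε for f(x₀+ε·) and w(ε) = ε^α L(ε).

From coefficients to expansion. If enough moments of ψ vanish, its wavelet coefficients decay in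
both 2^m+2^(-m) and n fast enough to beat the assumed growth, so T_ε ψ / w(ε), expanded in the
conjugate wavelets, converges by dominated convergence (`exists_waveletCoeff_decay`,
`exists_convergesOnMoments`).

The moment conditions are then removed one at a time. Let the moments of ρ below N vanish and its
N-th moment be 1, and let ρ_a = a⁻¹ρ(·/a). Then a^(-N)ρ_a − ρ has no moments up to N, so G(ε) =
ε^(-N) T_ε ρ has increments G(aε) − G(ε) of size v(ε) = ε^(α−N) L(ε), with a limiting ratio. As α ≠
N, v has nonzero index, and a geometric-series argument gives a limit of (G − c)/v for some constant
c, zero when α < N (`exists_limit_of_increments`). Subtracting c x^N from f(x₀+·) makes the N-th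
moment condition superfluous; these constants are the coefficients of p. When no condition is left,
the limits define g, and comparing ε with aε shows that g is homogeneous.

From expansion to coefficients. The wavelets annihilate polynomials, so the limits exist at once.
The family (T_ε − p(ε·))/w(ε), 0 < ε ≤ ε₀, is pointwise bounded: near 0 by convergence, away from 0
because L is bounded below. Banach–Steinhaus bounds it by one Schwartz seminorm, which grows
polynomially along the wavelets. Some ε₀ with L bounded below always exists, by Karamata's measure
argument (`exists_increment_bound`). -/

noncomputable section

/-! ### Schwartz seminorms, completeness and Banach–Steinhaus -/

/-- The supremum of the Schwartz seminorms of index at most `(K, K)`. -/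
def schwartzSup (K : ℕ) : Seminorm ℂ 𝓢(ℝ, ℂ) :=
  (Finset.Iic (K, K)).sup (schwartzSeminormFamily ℂ ℝ ℂ)

theorem schwartzSup_mono {K K' : ℕ} (h : K ≤ K') (ψ : 𝓢(ℝ, ℂ)) :
    schwartzSup K ψ ≤ schwartzSup K' ψ :=
  Seminorm.le_def.1 (Finset.sup_mono (Finset.Iic_subset_Iic.2 (Prod.mk_le_mk.2 ⟨h, h⟩))) ψ

theorem one_add_pow_mul_le_schwartzSup {K k n : ℕ} (hk : k ≤ K) (hn : n ≤ K) (ψ : 𝓢(ℝ, ℂ))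
    (x : ℝ) : (1 + |x|) ^ k * ‖iteratedDeriv n ψ x‖ ≤ 2 ^ K * schwartzSup K ψ := by
  have := SchwartzMap.one_add_le_sup_seminorm_apply (𝕜 := ℂ) (m := (K, K)) hk hn ψ x
  rw [norm_iteratedFDeriv_eq_norm_iteratedDeriv, Real.norm_eq_abs] at this
  exact this

theorem schwartzSup_le {K : ℕ} {ψ : 𝓢(ℝ, ℂ)} {M : ℝ} (hM : 0 ≤ M)
    (h : ∀ k ≤ K, ∀ n ≤ K, ∀ x : ℝ, |x| ^ k * ‖iteratedDeriv n ψ x‖ ≤ M) :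
    schwartzSup K ψ ≤ M := by
  refine Seminorm.finset_sup_apply_le hM ?_
  rintro ⟨k, n⟩ hkn
  obtain ⟨hk, hn⟩ := Prod.mk_le_mk.1 (Finset.mem_Iic.1 hkn)
  exact SchwartzMap.seminorm_le_bound' ℂ k n ψ hM (h k hk n hn)

theorem exists_le_schwartzSup_of_continuous (q : Seminorm ℂ 𝓢(ℝ, ℂ)) (hq : Continuous q) :
    ∃ (K : ℕ) (C : ℝ), 0 < C ∧ ∀ ψ, q ψ ≤ C * schwartzSup K ψ := by
  obtain ⟨s, C, hC, h⟩ := Seminorm.bound_of_continuous (schwartz_withSeminorms ℂ ℝ ℂ) q hq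
  refine ⟨s.sup (fun i => max i.1 i.2), C, by positivity, fun ψ => (h ψ).trans ?_⟩
  rw [_root_.smul_apply, NNReal.smul_def, smul_eq_mul]
  gcongr
  refine Seminorm.le_def.1 (Finset.sup_mono fun i hi => ?_) ψ
  have := Finset.le_sup (f := fun i : ℕ × ℕ => max i.1 i.2) hi
  exact Finset.mem_Iic.2 (Prod.mk_le_mk.2
    ⟨(le_max_left _ _).trans this, (le_max_right _ _).trans this⟩)

theorem exists_norm_le_schwartzSup (T : 𝓢(ℝ, ℂ) →L[ℂ] ℂ) :
    ∃ (K : ℕ) (C : ℝ), 0 < C ∧ ∀ ψ, ‖T ψ‖ ≤ C * schwartzSup K ψ :=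
  exists_le_schwartzSup_of_continuous ((normSeminorm ℂ ℂ).comp T.toLinearMap)
    (continuous_norm.comp T.continuous)

theorem iteratedDeriv_sub_apply (ψ χ : 𝓢(ℝ, ℂ)) (n : ℕ) (x : ℝ) :
    iteratedDeriv n (ψ - χ) x = iteratedDeriv n ψ x - iteratedDeriv n χ x := by
  have := iteratedDeriv_sub (n := n) (x := x) (f := ψ) (g := χ)
    ((ψ.smooth n).contDiffAt) ((χ.smooth n).contDiffAt)
  simpa using this

theorem hasDerivAt_iteratedDeriv (ψ : 𝓢(ℝ, ℂ)) (n : ℕ) (x : ℝ) :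
    HasDerivAt (iteratedDeriv n ψ) (iteratedDeriv (n + 1) ψ x) x := by
  rw [iteratedDeriv_succ]
  exact ((ψ.smooth (n + 1 : ℕ)).differentiable_iteratedDeriv n
    (by exact_mod_cast Nat.lt_succ_self n) x).hasDerivAt

/-- Every derivative converges uniformly with every polynomial weight, so the pointwise limits `v n`
are successive derivatives of `v 0`. Completeness is wanted because it makes the space Baire, as
Banach–Steinhaus requires. -/
theorem schwartzMap_cauchySeq_converges (u : ℕ → 𝓢(ℝ, ℂ)) (hu : CauchySeq u) :
    ∃ v, Tendsto u atTop (𝓝 v) := by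
  have hsem : ∀ k n : ℕ, ∀ ε > 0, ∃ N, ∀ i ≥ N, ∀ j ≥ N,
      SchwartzMap.seminorm ℂ k n (u i - u j) < ε := by
    intro k n ε hε
    have hc := (schwartz_withSeminorms ℂ ℝ ℂ).continuous_seminorm (k, n)
    have ht : Tendsto (fun p : ℕ × ℕ => u p.1 - u p.2) atTop (𝓝 0) := by
      have h1 := hu.tendsto_uniformity
      rw [uniformity_eq_comap_nhds_zero_swapped, tendsto_comap_iff] at h1
      exact h1
    have h2 := ((hc.tendsto 0).comp ht).eventually (eventually_lt_nhds (b := ε) (by simpa using hε))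
    obtain ⟨⟨a, b⟩, hab⟩ := eventually_atTop.1 h2
    exact ⟨max a b, fun i hi j hj => hab (i, j)
      ⟨(le_max_left _ _).trans hi, (le_max_right _ _).trans hj⟩⟩
  have hpt : ∀ k n : ℕ, ∀ ε > 0, ∃ N, ∀ i ≥ N, ∀ j ≥ N, ∀ x : ℝ,
      |x| ^ k * ‖iteratedDeriv n (u i) x - iteratedDeriv n (u j) x‖ < ε := by
    intro k n ε hε
    obtain ⟨N, hN⟩ := hsem k n ε hε
    refine ⟨N, fun i hi j hj x => ?_⟩
    rw [← iteratedDeriv_sub_apply]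
    exact (SchwartzMap.le_seminorm' ℂ k n _ x).trans_lt (hN i hi j hj)
  have hlim : ∀ n : ℕ, ∀ x : ℝ, ∃ z, Tendsto (fun i => iteratedDeriv n (u i) x) atTop (𝓝 z) := by
    intro n x
    refine cauchySeq_tendsto_of_complete (Metric.cauchySeq_iff.2 fun ε hε => ?_)
    obtain ⟨N, hN⟩ := hpt 0 n ε hε
    exact ⟨N, fun i hi j hj => by simpa [dist_eq_norm] using hN i hi j hj x⟩
  choose v hv using hlim
  have hle : ∀ k n : ℕ, ∀ ε > 0, ∃ N, ∀ i ≥ N, ∀ x : ℝ,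
      |x| ^ k * ‖iteratedDeriv n (u i) x - v n x‖ ≤ ε := by
    intro k n ε hε
    obtain ⟨N, hN⟩ := hpt k n ε hε
    refine ⟨N, fun i hi x => ?_⟩
    refine le_of_tendsto (((tendsto_const_nhds.sub (hv n x)).norm).const_mul _)
      (eventually_atTop.2 ⟨N, fun j hj => (hN i hi j hj x).le⟩)
  have hderiv : ∀ n x, HasDerivAt (v n) (v (n + 1) x) x := by
    intro n x
    refine hasDerivAt_of_tendstoUniformly (f := fun i => iteratedDeriv n (u i))
      (f' := fun i => iteratedDeriv (n + 1) (u i)) (l := atTop) ?_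
      (Eventually.of_forall fun i y => hasDerivAt_iteratedDeriv (u i) n y) (hv n) x
    refine Metric.tendstoUniformly_iff.2 fun ε hε => ?_
    obtain ⟨N, hN⟩ := hle 0 (n + 1) (ε / 2) (half_pos hε)
    refine eventually_atTop.2 ⟨N, fun i hi y => ?_⟩
    have := hN i hi y
    rw [pow_zero, one_mul] at this
    rw [dist_comm, dist_eq_norm]
    linarith
  have hiter : ∀ n, iteratedDeriv n (v 0) = v n := by
    intro n
    induction n with
    | zero => simp
    | succ n ih =>
      rw [iteratedDeriv_succ, ih]
      exact funext fun x => (hderiv n x).deriv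
  have hsmooth : ContDiff ℝ (⊤ : ℕ∞) (v 0) := by
    refine contDiff_of_differentiable_iteratedDeriv fun n _ => ?_
    rw [hiter]
    exact fun x => (hderiv n x).differentiableAt
  let w : 𝓢(ℝ, ℂ) :=
    { toFun := v 0
      smooth' := hsmooth
      decay' := by
        intro k n
        obtain ⟨N, hN⟩ := hle k n 1 one_pos
        refine ⟨1 + SchwartzMap.seminorm ℂ k n (u N), fun x => ?_⟩
        rw [norm_iteratedFDeriv_eq_norm_iteratedDeriv, hiter, Real.norm_eq_abs]
        have h1 := hN N le_rfl x
        have h2 := SchwartzMap.le_seminorm' ℂ k n (u N) x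
        have h3 : ‖v n x‖ ≤ ‖iteratedDeriv n (u N) x - v n x‖ + ‖iteratedDeriv n (u N) x‖ := by
          rw [norm_sub_rev]
          simpa using norm_add_le (v n x - iteratedDeriv n (u N) x) (iteratedDeriv n (u N) x)
        have h4 : 0 ≤ |x| ^ k := by positivity
        nlinarith [mul_le_mul_of_nonneg_left h3 h4] }
  have hw : ∀ n, iteratedDeriv n w = v n := hiter
  refine ⟨w, ((schwartz_withSeminorms ℂ ℝ ℂ).tendsto_nhds_atTop u w).2 ?_⟩
  rintro ⟨k, n⟩ ε hε
  obtain ⟨N, hN⟩ := hle k n (ε / 2) (half_pos hε)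
  refine ⟨N, fun i hi => ?_⟩
  have : SchwartzMap.seminorm ℂ k n (u i - w) ≤ ε / 2 := by
    refine SchwartzMap.seminorm_le_bound' ℂ k n _ (half_pos hε).le fun x => ?_
    rw [iteratedDeriv_sub_apply, hw]
    exact hN i hi x
  exact this.trans_lt (half_lt_self hε)

instance schwartzMap_isCountablyGenerated_uniformity :
    (uniformity 𝓢(ℝ, ℂ)).IsCountablyGenerated := by
  rw [uniformity_eq_comap_nhds_zero]
  infer_instance

instance schwartzMap_completeSpace : CompleteSpace 𝓢(ℝ, ℂ) :=
  UniformSpace.complete_of_cauchySeq_tendsto schwartzMap_cauchySeq_converges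

instance schwartzMap_baireSpace : BaireSpace 𝓢(ℝ, ℂ) :=
  letI := UniformSpace.pseudoMetricSpace 𝓢(ℝ, ℂ)
  inferInstance

/-- **Banach-Steinhaus** for families of tempered distributions. -/
theorem exists_uniform_schwartzSup_bound {ι : Type*} (T : ι → 𝓢(ℝ, ℂ) →L[ℂ] ℂ)
    (hT : ∀ ψ, ∃ M, ∀ i, ‖T i ψ‖ ≤ M) :
    ∃ (K : ℕ) (C : ℝ), 0 < C ∧ ∀ i ψ, ‖T i ψ‖ ≤ C * schwartzSup K ψ := by
  have hq := norm_withSeminorms ℂ ℂ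
  have hue := hq.banach_steinhaus (𝓕 := T) fun _ ψ => by
    obtain ⟨M, hM⟩ := hT ψ
    exact ⟨M, by rintro _ ⟨i, rfl⟩; exact hM i⟩
  obtain ⟨p, hp, hpT⟩ := (hq.uniformEquicontinuous_iff_exists_continuous_seminorm
    (fun i => (T i).toLinearMap)).1 hue 0
  obtain ⟨K, C, hC, h⟩ := exists_le_schwartzSup_of_continuous p hp
  exact ⟨K, C, hC, fun i ψ => (hpT i ψ).trans (h ψ)⟩

/-- A pointwise limit of tempered distributions along `ε → 0⁺` is a tempered distribution. -/
theorem exists_distribution_of_tendsto (T : ℝ → 𝓢(ℝ, ℂ) →L[ℂ] ℂ)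
    (hT : ∀ ψ, ∃ l, Tendsto (fun ε => T ε ψ) (𝓝[>] 0) (𝓝 l)) :
    ∃ g : 𝓢'(ℝ, ℂ), ∀ ψ, Tendsto (fun ε => T ε ψ) (𝓝[>] 0) (𝓝 (g ψ)) := by
  choose l hl using hT
  let g : 𝓢(ℝ, ℂ) →L[ℂ] ℂ :=
    continuousLinearMapOfTendsto (l := 𝓝[>] (0 : ℝ)) T (f := l) (tendsto_pi_nhds.2 hl)
  exact ⟨g, hl⟩

/-! ### Local bounds for slowly varying functions -/

/-- Local boundedness of increments of additively slowly varying functions (Karamata). -/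
theorem exists_increment_bound {h : ℝ → ℝ} (hm : Measurable h)
    (hs : ∀ u : ℝ, Tendsto (fun x => h (x + u) - h x) atTop (𝓝 0)) :
    ∃ X, ∀ x ≥ X, ∀ u ∈ Set.Icc (0 : ℝ) 1, |h (x + u) - h x| ≤ 1 := by
  by_contra! hcon
  choose x hx u hu hbad using fun n : ℕ => hcon n
  have hxt : Tendsto x atTop atTop := tendsto_atTop_mono hx tendsto_natCast_atTop_atTop
  have hyt : Tendsto (fun n => x n + u n) atTop atTop :=
    tendsto_atTop_mono (fun n => (hx n).trans (le_add_of_nonneg_right (hu n).1))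
      tendsto_natCast_atTop_atTop
  let μ : Measure ℝ := volume.restrict (Set.Icc 0 2)
  -- Along any sequence tending to infinity the increments tend to 0 pointwise in t, hence in
  -- measure on [0,2]. This is where measurability enters.
  have key : ∀ y : ℕ → ℝ, Tendsto y atTop atTop →
      Tendsto (fun n => volume ({t : ℝ | 1 / 2 ≤ |h (y n + t) - h (y n)|} ∩ Set.Icc 0 2))
        atTop (𝓝 0) := by
    intro y hy
    have hmeas : ∀ n, Measurable fun t => h (y n + t) - h (y n) := fun n =>
      (hm.comp (measurable_const_add _)).sub_const _
    have h1 : TendstoInMeasure μ (fun n t => h (y n + t) - h (y n)) atTop (fun _ => (0 : ℝ)) :=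
      tendstoInMeasure_of_tendsto_ae (fun n => (hmeas n).aestronglyMeasurable)
        (Eventually.of_forall fun t => (hs t).comp hy)
    rw [tendstoInMeasure_iff_norm] at h1
    have h2 := h1 (1 / 2) (by norm_num)
    refine h2.congr fun n => ?_
    rw [Measure.restrict_apply']
    · simp
    · exact measurableSet_Icc
  have e1 := (key x hxt).eventually (eventually_lt_nhds (b := ENNReal.ofReal (1 / 2))
    (by simp))
  have e2 := (key _ hyt).eventually (eventually_lt_nhds (b := ENNReal.ofReal (1 / 2))
    (by simp))
  obtain ⟨n, h1, h2⟩ := (e1.and e2).exists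
  set B₁ := {t : ℝ | 1 / 2 ≤ |h (x n + t) - h (x n)|} ∩ Set.Icc 0 2
  set B₂ := {t : ℝ | 1 / 2 ≤ |h (x n + u n + t) - h (x n + u n)|} ∩ Set.Icc 0 2
  -- A t outside both exceptional sets would put h(x+t) within 1/2 of both h(x) and h(x+u),
  -- contradicting the choice of u. So two sets of measure below 1/2 would cover an interval of
  -- length 1.
  have hsub : Set.Icc (1 : ℝ) 2 ⊆ B₁ ∪ (fun t => t + -u n) ⁻¹' B₂ := by
    intro t ht
    by_contra hnot
    rw [Set.mem_union, not_or] at hnot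
    have hu' := hu n
    have a1 : |h (x n + t) - h (x n)| < 1 / 2 := by
      by_contra! hc
      exact hnot.1 ⟨hc, by linarith [ht.1], ht.2⟩
    have a2 : |h (x n + t) - h (x n + u n)| < 1 / 2 := by
      by_contra! hc
      refine hnot.2 ⟨?_, ?_, ?_⟩
      · change 1 / 2 ≤ |h (x n + u n + (t + -u n)) - h (x n + u n)|
        rwa [show x n + u n + (t + -u n) = x n + t by ring]
      · change 0 ≤ t + -u n
        linarith [ht.1, hu'.2]
      · change t + -u n ≤ 2
        linarith [ht.2, hu'.1]
    have a3 := abs_sub_le (h (x n + u n)) (h (x n + t)) (h (x n))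
    rw [abs_sub_comm (h (x n + u n)) (h (x n + t))] at a3
    linarith [hbad n]
  have hlt : volume (Set.Icc (1 : ℝ) 2) < ENNReal.ofReal 1 := by
    calc volume (Set.Icc (1 : ℝ) 2) ≤ volume B₁ + volume ((fun t => t + -u n) ⁻¹' B₂) :=
          (measure_mono hsub).trans (measure_union_le _ _)
      _ = volume B₁ + volume B₂ := by rw [measure_preimage_add_right]
      _ < ENNReal.ofReal (1 / 2) + ENNReal.ofReal (1 / 2) := ENNReal.add_lt_add h1 h2
      _ = ENNReal.ofReal 1 := by
        rw [← ENNReal.ofReal_add (by norm_num) (by norm_num)]; norm_num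
  rw [Real.volume_Icc] at hlt
  norm_num at hlt

namespace IsSlowlyVaryingAtZero

variable {L : ℝ → ℝ} {A : ℝ}

/-- A slowly varying function is bounded away from zero on compact subintervals near the origin. -/
theorem exists_bounded_below (hL : IsSlowlyVaryingAtZero L A) :
    ∃ ε₀ ∈ Set.Ioc 0 A, ∀ δ ∈ Set.Ioc 0 ε₀, ∃ c : ℝ, 0 < c ∧ ∀ ε ∈ Set.Icc δ ε₀, c ≤ L ε := by
  classical
  -- `L` is arbitrary off (0,A]; the cutoff is measurable on the whole line.
  let M : ℝ → ℝ := (Set.Ioc 0 A).indicator L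
  have hM : Measurable M := by
    refine measurable_of_restrict_of_restrict_compl (measurableSet_Ioc (a := 0) (b := A)) ?_ ?_
    · convert! hL.measurable using 1
      funext x
      simp [M]
    · convert! measurable_const (a := (0 : ℝ)) using 1
      funext x
      exact Set.indicator_of_notMem x.2 _
  let h : ℝ → ℝ := fun x => Real.log (M (Real.exp (-x)))
  have hh : Measurable h := Real.measurable_log.comp (hM.comp (by fun_prop))
  have hexp : Tendsto (fun x : ℝ => Real.exp (-x)) atTop (𝓝[>] 0) :=
    tendsto_nhdsWithin_iff.2 ⟨Real.tendsto_exp_neg_atTop_nhds_zero,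
      Eventually.of_forall fun x => Real.exp_pos _⟩
  have hsmall : ∀ x, -Real.log A ≤ x → Real.exp (-x) ∈ Set.Ioc 0 A := fun x hx =>
    ⟨Real.exp_pos _, by
      rw [← Real.le_log_iff_exp_le hL.A_pos]; linarith⟩
  have hval : ∀ x, -Real.log A ≤ x → h x = Real.log (L (Real.exp (-x))) := fun x hx => by
    simp only [h, M, Set.indicator_of_mem (hsmall x hx)]
  have hs : ∀ u : ℝ, Tendsto (fun x => h (x + u) - h x) atTop (𝓝 0) := by
    intro u
    have h1 := (hL.ratio (Real.exp (-u)) (Real.exp_pos _)).comp hexp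
    have h2 := (Real.continuousAt_log one_ne_zero).tendsto.comp h1
    rw [Real.log_one] at h2
    refine h2.congr' ?_
    filter_upwards [eventually_ge_atTop (-Real.log A), eventually_ge_atTop (-Real.log A - u)]
      with x hx hxu
    have hxu' : -Real.log A ≤ x + u := by linarith
    have p1 := hL.pos _ (hsmall x hx)
    have p2 := hL.pos _ (hsmall _ hxu')
    have he : Real.exp (-u) * Real.exp (-x) = Real.exp (-(x + u)) := by
      rw [← Real.exp_add]; ring_nf
    simp only [Function.comp_apply, he]
    rw [hval x hx, hval _ hxu', Real.log_div p2.ne' p1.ne']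
  obtain ⟨X, hX⟩ := exists_increment_bound hh hs
  set Y := max X (-Real.log A)
  -- Each step of length at most 1 costs at most 1, so n steps from Y lower h by at most n.
  have hlow : ∀ n : ℕ, ∀ x ≥ Y, x ≤ Y + n → h Y - n ≤ h x := by
    intro n
    induction n with
    | zero =>
      intro x hx hx'
      have : x = Y := le_antisymm (by simpa using hx') hx
      simp [this]
    | succ n ih =>
      intro x hx hx'
      push_cast at hx' ⊢
      rcases le_total x (Y + 1) with hc | hc
      · have h1 := hX Y (le_max_left _ _) (x - Y) ⟨by linarith, by linarith⟩
        rw [add_sub_cancel] at h1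
        have := (abs_le.1 h1).1
        have hn : (0 : ℝ) ≤ n := by positivity
        linarith
      · have h1 := hX (x - 1) (by linarith [le_max_left X (-Real.log A)]) 1 (by simp)
        rw [sub_add_cancel] at h1
        have := (abs_le.1 h1).1
        have := ih (x - 1) (by linarith) (by linarith)
        linarith
  refine ⟨Real.exp (-Y), hsmall Y (le_max_right _ _), fun δ hδ => ?_⟩
  obtain ⟨n, hn⟩ := exists_nat_ge (-Real.log δ - Y)
  refine ⟨Real.exp (h Y - n), Real.exp_pos _, fun ε hε => ?_⟩
  have hε0 : 0 < ε := hδ.1.trans_le hε.1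
  have hx1 : Y ≤ -Real.log ε := by
    have := Real.log_le_log hε0 hε.2
    rw [Real.log_exp] at this
    linarith
  have hx2 : -Real.log ε ≤ Y + n := by
    have := Real.log_le_log hδ.1 hε.1
    linarith
  have h1 := hlow n _ hx1 hx2
  have hA : -Real.log A ≤ -Real.log ε := (le_max_right _ _).trans hx1
  rw [hval _ hA, neg_neg, Real.exp_log hε0] at h1
  have hmem := hsmall _ hA
  rw [neg_neg, Real.exp_log hε0] at hmem
  exact (Real.le_log_iff_exp_le (hL.pos ε hmem)).1 h1

end IsSlowlyVaryingAtZero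

/-! ### Asymptotics of a function from those of its increments -/

theorem tendsto_const_mul_nhdsGT_zero {b : ℝ} (hb : 0 < b) :
    Tendsto (fun ε : ℝ => b * ε) (𝓝[>] 0) (𝓝[>] 0) := by
  refine tendsto_nhdsWithin_iff.2 ⟨?_, ?_⟩
  · have : Tendsto (fun ε : ℝ => b * ε) (𝓝 0) (𝓝 (b * 0)) := tendsto_id.const_mul b
    rw [mul_zero] at this
    exact this.mono_left nhdsWithin_le_nhds
  · filter_upwards [self_mem_nhdsWithin] with ε hε
    exact mul_pos hb hε

/-- The limit z is the fixed point of r = k r + l. The deviation r − z satisfies the same recurrence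
with a forcing term tending to 0, and since r is bounded, iterating the contraction forces it to 0.
-/
theorem tendsto_of_contracting_recurrence {r e : ℝ → ℂ} {κ : ℝ → ℝ} {k b M : ℝ} {l : ℂ}
    (hb : 0 < b) (hk0 : 0 ≤ k) (hk1 : k < 1) (hκ : Tendsto κ (𝓝[>] 0) (𝓝 k))
    (he : Tendsto e (𝓝[>] 0) (𝓝 l)) (hr : ∀ᶠ ε in 𝓝[>] 0, ‖r ε‖ ≤ M)
    (hrec : ∀ᶠ ε in 𝓝[>] 0, r ε = κ ε * r (b * ε) + e ε) :
    Tendsto r (𝓝[>] 0) (𝓝 (l / (1 - k))) := by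
  set z : ℂ := l / (1 - k)
  have hk : (1 - k : ℂ) ≠ 0 := by
    have : (1 - k : ℝ) ≠ 0 := by linarith
    exact_mod_cast this
  have he' : Tendsto (fun ε => e ε + ((κ ε : ℂ) - 1) * z) (𝓝[>] 0) (𝓝 0) := by
    have h1 : Tendsto (fun ε => (κ ε : ℂ)) (𝓝[>] 0) (𝓝 (k : ℂ)) :=
      (Complex.continuous_ofReal.tendsto k).comp hκ
    have h2 := he.add ((h1.sub_const 1).mul_const z)
    have : l + ((k : ℂ) - 1) * z = 0 := by
      simp only [z]; field_simp; ring
    rwa [this] at h2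
  set q : ℝ := (k + 1) / 2
  have hq0 : 0 < q := by simp only [q]; linarith
  have hq1 : q < 1 := by simp only [q]; linarith
  have hκq : ∀ᶠ ε in 𝓝[>] 0, |κ ε| ≤ q := by
    have h1 : Tendsto (fun ε => |κ ε|) (𝓝[>] 0) (𝓝 k) := by
      simpa [abs_of_nonneg hk0] using hκ.abs
    exact (h1.eventually (eventually_lt_nhds (by simp only [q]; linarith))).mono fun _ h => h.le
  -- The number η/(1−q) is fixed under y ↦ qy + η. The range of admissible ε depends on j, which is
  -- harmless because j is chosen before ε → 0.
  have hs : ∀ η > 0, ∀ j : ℕ, ∀ᶠ ε in 𝓝[>] 0,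
      ‖r ε - z‖ ≤ q ^ j * (M + ‖z‖) + η / (1 - q) := by
    intro η hη j
    induction j with
    | zero =>
      filter_upwards [hr] with ε h1
      have h2 := norm_sub_le (r ε) z
      have : 0 ≤ η / (1 - q) := div_nonneg hη.le (by linarith)
      rw [pow_zero, one_mul]
      linarith
    | succ j ih =>
      filter_upwards [hrec, hκq, (tendsto_const_mul_nhdsGT_zero hb).eventually ih,
        (tendsto_zero_iff_norm_tendsto_zero.1 he').eventually (eventually_lt_nhds hη)]
        with ε h1 h2 h3 h4
      have h5 : r ε - z = κ ε * (r (b * ε) - z) + (e ε + ((κ ε : ℂ) - 1) * z) := by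
        rw [h1]; ring
      have h6 : η / (1 - q) = q * (η / (1 - q)) + η := by
        have : (1 - q) ≠ 0 := by linarith
        field_simp; ring
      calc ‖r ε - z‖ ≤ |κ ε| * ‖r (b * ε) - z‖ + η := by
            rw [h5]
            refine (norm_add_le _ _).trans (add_le_add ?_ h4.le)
            rw [norm_mul, Complex.norm_real, Real.norm_eq_abs]
        _ ≤ q * (q ^ j * (M + ‖z‖) + η / (1 - q)) + η := by gcongr
        _ = q ^ (j + 1) * (M + ‖z‖) + η / (1 - q) := by rw [pow_succ]; linarith
  refine Metric.tendsto_nhds.2 fun δ hδ => ?_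
  have hj : Tendsto (fun j : ℕ => q ^ j * (M + ‖z‖)) atTop (𝓝 0) := by
    simpa using (tendsto_pow_atTop_nhds_zero_of_lt_one hq0.le hq1).mul_const (M + ‖z‖)
  obtain ⟨j, hj⟩ := (hj.eventually (eventually_lt_nhds (half_pos hδ))).exists
  have h1q : 0 < 1 - q := by linarith
  filter_upwards [hs ((1 - q) * (δ / 2)) (by positivity) j] with ε hε
  rw [mul_div_cancel_left₀ _ h1q.ne'] at hε
  rw [dist_eq_norm]
  linarith

section IncrementLimits

variable {v : ℝ → ℝ} {G : ℝ → ℂ} {τ ε₁ : ℝ}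

theorem pos_of_bounded_below
    (hv : ∀ δ ∈ Set.Ioc 0 ε₁, ∃ c : ℝ, 0 < c ∧ ∀ ε ∈ Set.Icc δ ε₁, c ≤ v ε) :
    ∀ ε ∈ Set.Ioc 0 ε₁, 0 < v ε := fun ε hε => by
  obtain ⟨c, hc, h⟩ := hv ε hε
  exact hc.trans_le (h ε ⟨le_rfl, hε.2⟩)

theorem exists_geometric_step (hε₁ : 0 < ε₁) (hv : ∀ ε ∈ Set.Ioc 0 ε₁, 0 < v ε) {b : ℝ}
    (hb : 0 < b) (hbτ : b ^ τ < 1)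
    (hratio : Tendsto (fun ε => v (b * ε) / v ε) (𝓝[>] 0) (𝓝 (b ^ τ))) {l : ℂ}
    (hinc : Tendsto (fun ε => (G (b * ε) - G ε) / v ε) (𝓝[>] 0) (𝓝 l)) :
    ∃ ε₂ > 0, ∃ q K : ℝ, ε₂ ≤ ε₁ ∧ b * ε₂ ≤ ε₁ ∧ 0 < q ∧ q < 1 ∧ 0 ≤ K ∧
      ∀ ε ∈ Set.Ioc 0 ε₂, v (b * ε) ≤ q * v ε ∧ ‖G (b * ε) - G ε‖ ≤ K * v ε := by
  have hb' : 0 < b ^ τ := Real.rpow_pos_of_pos hb τ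
  obtain ⟨q, hq, hq1⟩ := exists_between hbτ
  have h1 := hratio.eventually (eventually_lt_nhds hq)
  have h2 := hinc.norm.eventually (eventually_lt_nhds (lt_add_one ‖l‖))
  have h3 : ∀ᶠ ε in 𝓝[>] (0 : ℝ), ε ≤ ε₁ := eventually_nhdsWithin_of_eventually_nhds
    (eventually_le_nhds hε₁)
  have h4 := (tendsto_const_mul_nhdsGT_zero hb).eventually h3
  obtain ⟨ε₂, hε₂, h⟩ := mem_nhdsGT_iff_exists_Ioc_subset.1 (h1.and (h2.and (h3.and h4)))
  have hend := h (Set.right_mem_Ioc.2 hε₂)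
  refine ⟨ε₂, hε₂, q, ‖l‖ + 1, hend.2.2.1, hend.2.2.2, hb'.trans hq, hq1, by positivity,
    fun ε hε => ?_⟩
  obtain ⟨a1, a2, a3, -⟩ := h hε
  have hpos := hv ε ⟨hε.1, a3⟩
  refine ⟨((div_lt_iff₀ hpos).1 a1).le, ?_⟩
  rw [norm_div, Complex.norm_real, Real.norm_of_nonneg hpos.le, div_lt_iff₀ hpos] at a2
  exact a2.le

/-- With r = (G − c)/v one has r(ε) = (v(bε)/v(ε)) r(bε) − (G(bε) − G(ε))/v(ε), a contracting
recurrence because b^τ < 1. Only boundedness of r remains to be supplied. -/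
theorem exists_limit_of_bounded_quotient (hε₁ : 0 < ε₁) (hv : ∀ ε ∈ Set.Ioc 0 ε₁, 0 < v ε)
    {b : ℝ} (hb : 0 < b) (hbτ : b ^ τ < 1)
    (hratio : Tendsto (fun ε => v (b * ε) / v ε) (𝓝[>] 0) (𝓝 (b ^ τ))) {l : ℂ}
    (hinc : Tendsto (fun ε => (G (b * ε) - G ε) / v ε) (𝓝[>] 0) (𝓝 l)) {c : ℂ} {M : ℝ}
    (hbd : ∀ᶠ ε in 𝓝[>] 0, ‖(G ε - c) / v ε‖ ≤ M) :
    ∃ l', Tendsto (fun ε => (G ε - c) / v ε) (𝓝[>] 0) (𝓝 l') := by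
  have hev : ∀ᶠ ε in 𝓝[>] (0 : ℝ), 0 < v ε := by
    filter_upwards [Ioc_mem_nhdsGT hε₁] with ε hε using hv ε hε
  refine ⟨_, tendsto_of_contracting_recurrence hb (Real.rpow_pos_of_pos hb τ).le hbτ hratio
    hinc.neg hbd ?_⟩
  filter_upwards [hev, (tendsto_const_mul_nhdsGT_zero hb).eventually hev] with ε h1 h2
  have h1' : (v ε : ℂ) ≠ 0 := by exact_mod_cast h1.ne'
  have h2' : (v (b * ε) : ℂ) ≠ 0 := by exact_mod_cast h2.ne'
  push_cast
  field_simp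
  ring

/-- For τ < 0 the contraction needs b = 2: a small ε is doubled until it reaches a range where G is
bounded and v is bounded below, so no constant appears. -/
theorem exists_limit_of_increments_of_neg (hτ : τ < 0) (hε₁ : 0 < ε₁)
    (hv : ∀ δ ∈ Set.Ioc 0 ε₁, ∃ c : ℝ, 0 < c ∧ ∀ ε ∈ Set.Icc δ ε₁, c ≤ v ε)
    (hG : ∀ δ ∈ Set.Ioc 0 ε₁, ∃ M : ℝ, ∀ ε ∈ Set.Icc δ ε₁, ‖G ε‖ ≤ M)
    (hratio : ∀ a : ℝ, 0 < a → Tendsto (fun ε => v (a * ε) / v ε) (𝓝[>] 0) (𝓝 (a ^ τ)))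
    (hinc : ∀ a : ℝ, 0 < a → ∃ l, Tendsto (fun ε => (G (a * ε) - G ε) / v ε) (𝓝[>] 0) (𝓝 l)) :
    ∃ l, Tendsto (fun ε => G ε / v ε) (𝓝[>] 0) (𝓝 l) := by
  have hpos := pos_of_bounded_below hv
  have h2 : (2 : ℝ) ^ τ < 1 := Real.rpow_lt_one_of_one_lt_of_neg (by norm_num) hτ
  obtain ⟨l, hl⟩ := hinc 2 two_pos
  obtain ⟨ε₂, hε₂, q, K, -, h2ε, hq0, hq1, hK, hstep⟩ :=
    exists_geometric_step hε₁ hpos two_pos h2 (hratio 2 two_pos) hl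
  have hmem : ε₂ ∈ Set.Ioc 0 ε₁ := ⟨hε₂, by linarith⟩
  obtain ⟨c, hc, hcv⟩ := hv ε₂ hmem
  obtain ⟨M, hM⟩ := hG ε₂ hmem
  set B := max (M / c) (K / (1 - q))
  have hM0 : 0 ≤ M := (norm_nonneg _).trans (hM ε₂ ⟨le_rfl, hmem.2⟩)
  -- Induction on the number of doublings needed to reach ε₂. The constant B covers the base range
  -- and satisfies qB + K ≤ B, so it survives each step.
  have hbd : ∀ j : ℕ, ∀ ε ∈ Set.Ioc 0 (2 * ε₂), ε₂ ≤ 2 ^ j * ε → ‖G ε‖ ≤ B * v ε := by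
    have hbase : ∀ ε ∈ Set.Ioc 0 (2 * ε₂), ε₂ ≤ ε → ‖G ε‖ ≤ B * v ε := by
      intro ε hε hj
      have hI : ε ∈ Set.Icc ε₂ ε₁ := ⟨hj, hε.2.trans h2ε⟩
      calc ‖G ε‖ ≤ M := hM ε hI
        _ = M / c * c := by field_simp
        _ ≤ B * v ε := mul_le_mul (le_max_left _ _) (hcv ε hI) hc.le
            ((div_nonneg hM0 hc.le).trans (le_max_left _ _))
    intro j
    induction j with
    | zero => exact fun ε hε hj => hbase ε hε (by simpa using hj)
    | succ j ih =>
      intro ε hε hj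
      rcases le_total ε₂ ε with hc' | hc'
      · exact hbase ε hε hc'
      · obtain ⟨s1, s2⟩ := hstep ε ⟨hε.1, hc'⟩
        have h3 := ih (2 * ε) ⟨by linarith [hε.1], by linarith⟩ (by rw [pow_succ] at hj; linarith)
        have hvε := hpos ε ⟨hε.1, by linarith⟩
        have hB : K ≤ B * (1 - q) := by
          rw [← div_le_iff₀ (by linarith)]; exact le_max_right _ _
        have hB0 : 0 ≤ B := (div_nonneg hM0 hc.le).trans (le_max_left _ _)
        have h4 : ‖G ε‖ ≤ ‖G (2 * ε)‖ + ‖G (2 * ε) - G ε‖ := by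
          have := norm_sub_le (G (2 * ε)) (G (2 * ε) - G ε)
          rwa [sub_sub_cancel] at this
        have h5 := mul_le_mul_of_nonneg_left s1 hB0
        have h6 := mul_le_mul_of_nonneg_right hB hvε.le
        nlinarith
  have hev : ∀ᶠ ε in 𝓝[>] 0, ‖(G ε - 0) / v ε‖ ≤ B := by
    filter_upwards [Ioc_mem_nhdsGT hε₂] with ε hε
    have hvε := hpos ε ⟨hε.1, hε.2.trans hmem.2⟩
    obtain ⟨j, hj⟩ := pow_unbounded_of_one_lt (ε₂ / ε) (one_lt_two (α := ℝ))
    rw [sub_zero, norm_div, Complex.norm_real, Real.norm_of_nonneg hvε.le, div_le_iff₀ hvε]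
    exact hbd j ε ⟨hε.1, by linarith [hε.2]⟩ ((div_le_iff₀ hε.1).1 hj.le)
  simpa using exists_limit_of_bounded_quotient hε₁ hpos two_pos h2 (hratio 2 two_pos) hl hev

/-- For τ > 0 the contraction needs b = 1/2: v decays geometrically under halving, so G is Cauchy
along each dyadic sequence, and c is its limit. -/
theorem exists_limit_of_increments_of_pos (hτ : 0 < τ) (hε₁ : 0 < ε₁)
    (hv : ∀ ε ∈ Set.Ioc 0 ε₁, 0 < v ε)
    (hratio : ∀ a : ℝ, 0 < a → Tendsto (fun ε => v (a * ε) / v ε) (𝓝[>] 0) (𝓝 (a ^ τ)))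
    (hinc : ∀ a : ℝ, 0 < a → ∃ l, Tendsto (fun ε => (G (a * ε) - G ε) / v ε) (𝓝[>] 0) (𝓝 l)) :
    ∃ c l, Tendsto (fun ε => (G ε - c) / v ε) (𝓝[>] 0) (𝓝 l) := by
  have h2 : (1 / 2 : ℝ) ^ τ < 1 := Real.rpow_lt_one (by norm_num) (by norm_num) hτ
  have hhalf : (0 : ℝ) < 1 / 2 := by norm_num
  obtain ⟨l, hl⟩ := hinc (1 / 2) hhalf
  obtain ⟨ε₂, hε₂, q, K, hε₂₁, -, hq0, hq1, hK, hstep⟩ :=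
    exists_geometric_step hε₁ hv hhalf h2 (hratio _ hhalf) hl
  have hmem : ∀ ε ∈ Set.Ioc 0 ε₂, ∀ j : ℕ, (1 / 2) ^ j * ε ∈ Set.Ioc 0 ε₂ := fun ε hε j =>
    ⟨mul_pos (by positivity) hε.1, (mul_le_of_le_one_left hε.1.le
      (pow_le_one₀ (by norm_num) (by norm_num))).trans hε.2⟩
  have hgeo : ∀ ε ∈ Set.Ioc 0 ε₂, ∀ j : ℕ, v ((1 / 2) ^ j * ε) ≤ q ^ j * v ε := by
    intro ε hε j
    induction j with
    | zero => simp
    | succ j ih =>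
      have := (hstep _ (hmem ε hε j)).1
      rw [← mul_assoc, ← pow_succ'] at this
      calc _ ≤ _ := this
        _ ≤ q * (q ^ j * v ε) := by gcongr
        _ = q ^ (j + 1) * v ε := by ring
  have hdist : ∀ ε ∈ Set.Ioc 0 ε₂, ∀ j : ℕ,
      dist (G ((1 / 2) ^ j * ε)) (G ((1 / 2) ^ (j + 1) * ε)) ≤ K * v ε * q ^ j := by
    intro ε hε j
    have := (hstep _ (hmem ε hε j)).2
    rw [← mul_assoc, ← pow_succ'] at this
    rw [dist_comm, dist_eq_norm]
    calc _ ≤ _ := this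
      _ ≤ K * (q ^ j * v ε) := by gcongr; exact hgeo ε hε j
      _ = _ := by ring
  have hlim : ∀ ε ∈ Set.Ioc 0 ε₂, ∃ z, Tendsto (fun j : ℕ => G ((1 / 2) ^ j * ε)) atTop (𝓝 z) ∧
      ‖G ε - z‖ ≤ K * v ε / (1 - q) := by
    intro ε hε
    obtain ⟨z, hz⟩ := cauchySeq_tendsto_of_complete (cauchySeq_of_le_geometric q _ hq1 (hdist ε hε))
    have := dist_le_of_le_geometric_of_tendsto₀ q _ hq1 (hdist ε hε) hz
    exact ⟨z, hz, by simpa [dist_eq_norm] using this⟩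
  obtain ⟨c, hc, -⟩ := hlim ε₂ ⟨hε₂, le_rfl⟩
  have hconst : ∀ ε ∈ Set.Ioc 0 ε₂, ‖G ε - c‖ ≤ K * v ε / (1 - q) := by
    intro ε hε
    obtain ⟨z, hz, hzb⟩ := hlim ε hε
    have ha : 0 < ε / ε₂ := div_pos hε.1 hε₂
    obtain ⟨l', hl'⟩ := hinc _ ha
    have hseq : Tendsto (fun j : ℕ => (1 / 2 : ℝ) ^ j * ε₂) atTop (𝓝[>] 0) := by
      refine tendsto_nhdsWithin_iff.2 ⟨?_, Eventually.of_forall fun j =>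
        (hmem ε₂ ⟨hε₂, le_rfl⟩ j).1⟩
      simpa using (tendsto_pow_atTop_nhds_zero_of_lt_one hhalf.le (by norm_num)).mul_const ε₂
    have hvz : Tendsto (fun j : ℕ => v ((1 / 2) ^ j * ε₂)) atTop (𝓝 0) := by
      refine squeeze_zero (fun j => ?_) (hgeo ε₂ ⟨hε₂, le_rfl⟩) ?_
      · have := hmem ε₂ ⟨hε₂, le_rfl⟩ j
        exact (hv _ ⟨this.1, this.2.trans hε₂₁⟩).le
      · simpa using (tendsto_pow_atTop_nhds_zero_of_lt_one hq0.le hq1).mul_const (v ε₂)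
    have h1 := (hl'.comp hseq).mul ((Complex.continuous_ofReal.tendsto 0).comp hvz)
    -- The limit does not depend on the starting point: increments with ratio ε/ε₂ are O(v), and v
    -- tends to 0 along the sequence.
    have h3 : z = c := by
      have h4 := hz.sub hc
      rw [Complex.ofReal_zero, mul_zero] at h1
      have h5 := tendsto_nhds_unique (h1.congr fun j => ?_) h4
      · exact (sub_eq_zero.1 h5.symm)
      · have hm := hmem ε₂ ⟨hε₂, le_rfl⟩ j
        have hne : (v ((1 / 2) ^ j * ε₂) : ℂ) ≠ 0 := by
          exact_mod_cast (hv _ ⟨hm.1, hm.2.trans hε₂₁⟩).ne'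
        have hre : ε / ε₂ * ((1 / 2) ^ j * ε₂) = (1 / 2) ^ j * ε := by
          field_simp
        simp only [Function.comp_apply, hre]
        exact div_mul_cancel₀ _ hne
    rwa [h3] at hzb
  refine ⟨c, exists_limit_of_bounded_quotient (M := K / (1 - q)) hε₁ hv hhalf h2
    (hratio _ hhalf) hl ?_⟩
  filter_upwards [Ioc_mem_nhdsGT hε₂] with ε hε
  have hvε := hv ε ⟨hε.1, hε.2.trans hε₂₁⟩
  rw [norm_div, Complex.norm_real, Real.norm_of_nonneg hvε.le, div_le_iff₀ hvε]
  calc _ ≤ _ := hconst ε hε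
    _ = _ := by ring

/-- If the increments of `G` are asymptotically proportional to a regularly varying function `v`
of nonzero index `τ`, then so is `G` itself, up to a constant that vanishes for `τ < 0`. -/
theorem exists_limit_of_increments (hτ : τ ≠ 0) (hε₁ : 0 < ε₁)
    (hv : ∀ δ ∈ Set.Ioc 0 ε₁, ∃ c : ℝ, 0 < c ∧ ∀ ε ∈ Set.Icc δ ε₁, c ≤ v ε)
    (hG : ∀ δ ∈ Set.Ioc 0 ε₁, ∃ M : ℝ, ∀ ε ∈ Set.Icc δ ε₁, ‖G ε‖ ≤ M)
    (hratio : ∀ a : ℝ, 0 < a → Tendsto (fun ε => v (a * ε) / v ε) (𝓝[>] 0) (𝓝 (a ^ τ)))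
    (hinc : ∀ a : ℝ, 0 < a → ∃ l, Tendsto (fun ε => (G (a * ε) - G ε) / v ε) (𝓝[>] 0) (𝓝 l)) :
    ∃ c : ℂ, (τ < 0 → c = 0) ∧ ∃ l, Tendsto (fun ε => (G ε - c) / v ε) (𝓝[>] 0) (𝓝 l) := by
  rcases lt_or_gt_of_ne hτ with h | h
  · exact ⟨0, fun _ => rfl, by
      simpa using exists_limit_of_increments_of_neg h hε₁ hv hG hratio hinc⟩
  · obtain ⟨c, hc⟩ := exists_limit_of_increments_of_pos h hε₁
      (pos_of_bounded_below hv) hratio hinc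
    exact ⟨c, fun h' => absurd h' h.not_gt, hc⟩

end IncrementLimits

/-! ### Moments and seminorms under affine changes of variable -/

theorem hasTemperateGrowth_ofReal_pow (k : ℕ) :
    (fun x : ℝ => ((x ^ k : ℝ) : ℂ)).HasTemperateGrowth := by
  fun_prop

/-- The `k`-th moment of a Schwartz function. -/
def schwartzMoment (k : ℕ) : 𝓢(ℝ, ℂ) →L[ℂ] ℂ :=
  (SchwartzMap.integralCLM ℂ (volume : Measure ℝ)).comp
    (SchwartzMap.smulLeftCLM ℂ (fun x : ℝ => ((x ^ k : ℝ) : ℂ)))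

theorem schwartzMoment_apply (k : ℕ) (ψ : 𝓢(ℝ, ℂ)) :
    schwartzMoment k ψ = ∫ x : ℝ, ((x ^ k : ℝ) : ℂ) * ψ x := by
  change SchwartzMap.integralCLM ℂ (volume : Measure ℝ)
    (SchwartzMap.smulLeftCLM ℂ (fun x : ℝ => ((x ^ k : ℝ) : ℂ)) ψ) = _
  rw [SchwartzMap.integralCLM_apply]
  refine integral_congr_ae (Eventually.of_forall fun x => ?_)
  exact SchwartzMap.smulLeftCLM_apply_apply (hasTemperateGrowth_ofReal_pow k) ψ x

theorem integrable_pow_mul_schwartz (k : ℕ) (ψ : 𝓢(ℝ, ℂ)) :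
    Integrable fun x : ℝ => ((x ^ k : ℝ) : ℂ) * ψ x := by
  have := (SchwartzMap.smulLeftCLM ℂ (fun x : ℝ => ((x ^ k : ℝ) : ℂ)) ψ).integrable
    (μ := (volume : Measure ℝ))
  refine this.congr (Eventually.of_forall fun x => ?_)
  exact SchwartzMap.smulLeftCLM_apply_apply (hasTemperateGrowth_ofReal_pow k) ψ x

theorem schwartzMoment_affineComp {c : ℝ} (hc : 0 < c) (k : ℕ) (ψ : 𝓢(ℝ, ℂ)) :
    schwartzMoment k (affineComp c 0 ψ) = ((c⁻¹ ^ (k + 1) : ℝ) : ℂ) * schwartzMoment k ψ := by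
  rw [schwartzMoment_apply, schwartzMoment_apply]
  have h := Measure.integral_comp_mul_left (fun y : ℝ => (((c⁻¹ * y) ^ k : ℝ) : ℂ) * ψ y) c
  have h2 : ∀ x : ℝ, c⁻¹ * (c * x) = x := fun x => by field_simp
  simp only [h2] at h
  simp only [affineComp_apply hc.ne', add_zero]
  rw [h, abs_of_pos (inv_pos.2 hc), Complex.real_smul, ← integral_const_mul, ← integral_const_mul]
  refine integral_congr_ae (Eventually.of_forall fun x => ?_)
  push_cast
  ring

theorem iteratedDeriv_affineComp {c : ℝ} (hc : c ≠ 0) (b : ℝ) (ψ : 𝓢(ℝ, ℂ)) (n : ℕ) (x : ℝ) :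
    iteratedDeriv n (affineComp c b ψ) x = (c : ℂ) ^ n * iteratedDeriv n ψ (c * x + b) := by
  induction n generalizing x with
  | zero => simp [affineComp_apply hc]
  | succ n ih =>
    have h1 : HasDerivAt (fun y : ℝ => c * y + b) c x := by
      simpa using ((hasDerivAt_id x).const_mul c).add_const b
    have h2 := (hasDerivAt_iteratedDeriv ψ n (c * x + b)).scomp x h1
    have h3 := h2.const_mul ((c : ℂ) ^ n)
    rw [iteratedDeriv_succ, funext ih]
    refine h3.deriv.trans ?_
    rw [Complex.real_smul, pow_succ]
    ring

theorem one_le_add_inv {s : ℝ} (hs : 0 < s) : 1 ≤ s + 1 / s := by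
  rcases le_total 1 s with h | h
  · have : 0 < 1 / s := by positivity
    linarith
  · have := (one_le_div hs).2 h
    linarith

/-- Derivatives contribute at most c^K-type factors, and rewriting the weight in x as one in y = cx
+ b contributes powers of 1/c and 1+|b|; c + 1/c dominates c, 1/c and 1. -/
theorem schwartzSup_affineComp_le (K : ℕ) {c : ℝ} (hc : 0 < c) (b : ℝ) (ψ : 𝓢(ℝ, ℂ)) :
    schwartzSup K (affineComp c b ψ) ≤
      (c + 1 / c) ^ (2 * K) * (1 + |b|) ^ K * (2 ^ K * schwartzSup K ψ) := by
  have hS : 0 ≤ schwartzSup K ψ := apply_nonneg _ _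
  have hc' : 0 < 1 / c := by positivity
  have h1 := one_le_add_inv hc
  refine schwartzSup_le (by positivity) fun k hk n hn x => ?_
  rw [iteratedDeriv_affineComp hc.ne', norm_mul, norm_pow, Complex.norm_real, Real.norm_eq_abs,
    abs_of_pos hc]
  set y := c * x + b
  have hx : |x| ≤ 1 / c * ((1 + |b|) * (1 + |y|)) := by
    have : x = 1 / c * (y - b) := by simp only [y]; field_simp; ring
    rw [this, abs_mul, abs_of_pos hc']
    gcongr
    have := abs_sub y b
    nlinarith [abs_nonneg y, abs_nonneg b]
  have hκ1 : (1 / c) ^ k ≤ (c + 1 / c) ^ K :=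
    (pow_le_pow_left₀ hc'.le (by linarith) k).trans (pow_le_pow_right₀ h1 hk)
  have hκ2 : c ^ n ≤ (c + 1 / c) ^ K :=
    (pow_le_pow_left₀ hc.le (by linarith) n).trans (pow_le_pow_right₀ h1 hn)
  have hb : (1 + |b|) ^ k ≤ (1 + |b|) ^ K :=
    pow_le_pow_right₀ (by linarith [abs_nonneg b]) hk
  calc |x| ^ k * (c ^ n * ‖iteratedDeriv n ψ y‖)
      ≤ (1 / c * ((1 + |b|) * (1 + |y|))) ^ k * (c ^ n * ‖iteratedDeriv n ψ y‖) := by gcongr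
    _ = (1 / c) ^ k * c ^ n * (1 + |b|) ^ k * ((1 + |y|) ^ k * ‖iteratedDeriv n ψ y‖) := by
        rw [mul_pow, mul_pow]; ring
    _ ≤ (c + 1 / c) ^ K * (c + 1 / c) ^ K * (1 + |b|) ^ K * (2 ^ K * schwartzSup K ψ) := by
        refine mul_le_mul ?_ (one_add_pow_mul_le_schwartzSup hk hn ψ y) (by positivity)
          (by positivity)
        gcongr
    _ = _ := by rw [two_mul, pow_add]

theorem two_rpow_half_le (m : ℤ) : (2 : ℝ) ^ ((m : ℝ) / 2) ≤ (2 : ℝ) ^ m + 1 / (2 : ℝ) ^ m := by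
  have h2 : (0 : ℝ) < 2 ^ m := by positivity
  have h3 : (0 : ℝ) < 1 / 2 ^ m := by positivity
  rcases le_total 0 m with h | h
  · have h1 : (2 : ℝ) ^ ((m : ℝ) / 2) ≤ (2 : ℝ) ^ (m : ℝ) := by
      apply Real.rpow_le_rpow_of_exponent_le (by norm_num)
      have : (0 : ℝ) ≤ m := by exact_mod_cast h
      linarith
    rw [Real.rpow_intCast] at h1
    linarith
  · have h1 : (2 : ℝ) ^ ((m : ℝ) / 2) ≤ 1 := by
      apply Real.rpow_le_one_of_one_le_of_nonpos (by norm_num)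
      have : (m : ℝ) ≤ 0 := by exact_mod_cast h
      linarith
    exact h1.trans (one_le_add_inv h2)

theorem schwartzSup_waveletFun_le (K : ℕ) (φ : 𝓢(ℝ, ℂ)) (m n : ℤ) :
    schwartzSup K (waveletFun φ m n) ≤ ((2 : ℝ) ^ m + 1 / (2 : ℝ) ^ m) ^ (2 * K + 1) *
      (1 + |(n : ℝ)|) ^ K * (2 ^ K * schwartzSup K φ) := by
  have h2 : (0 : ℝ) < 2 ^ m := by positivity
  have h3 : (0 : ℝ) < 1 / 2 ^ m := by positivity
  have := schwartzSup_affineComp_le K h2 (-(n : ℝ)) φ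
  rw [abs_neg] at this
  rw [waveletFun, map_smul_eq_mul, Complex.norm_real, Real.norm_of_nonneg (by positivity)]
  calc _ ≤ ((2 : ℝ) ^ m + 1 / (2 : ℝ) ^ m) * (((2 : ℝ) ^ m + 1 / (2 : ℝ) ^ m) ^ (2 * K) *
      (1 + |(n : ℝ)|) ^ K * (2 ^ K * schwartzSup K φ)) :=
        mul_le_mul (two_rpow_half_le m) this (apply_nonneg _ _) (by positivity)
    _ = _ := by ring

theorem schwartzConj_waveletFun (φ : 𝓢(ℝ, ℂ)) (m n : ℤ) :
    schwartzConj (waveletFun φ m n) = waveletFun (schwartzConj φ) m n := by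
  ext x
  rw [schwartzConj_apply, waveletFun_apply, waveletFun_apply, schwartzConj_apply, map_mul,
    Complex.conj_ofReal]

/-- The pairings `f(x₀ + ε ·)`, as continuous linear functionals, are controlled by one Schwartz
seminorm, uniformly for `ε` in a compact subset of `(0, ∞)`. -/
theorem exists_affineDistribution_bound (f : 𝓢'(ℝ, ℂ)) (x₀ : ℝ) :
    ∃ K : ℕ, ∀ δ ε₀ : ℝ, 0 < δ → ∃ C : ℝ, 0 ≤ C ∧ ∀ ε ∈ Set.Icc δ ε₀, ∀ ψ : 𝓢(ℝ, ℂ),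
      ‖affineDistribution f x₀ ε ψ‖ ≤ C * schwartzSup K ψ := by
  obtain ⟨K, C, hC, hf⟩ := exists_norm_le_schwartzSup f
  refine ⟨K, fun δ ε₀ hδ => ⟨δ⁻¹ * (C * ((δ⁻¹ + |ε₀|) ^ (2 * K) * (1 + |x₀| / δ) ^ K * 2 ^ K)),
    by positivity, fun ε hε ψ => ?_⟩⟩
  have hε0 : 0 < ε := hδ.trans_le hε.1
  have hS : 0 ≤ schwartzSup K ψ := apply_nonneg _ _
  have hinv : ε⁻¹ ≤ δ⁻¹ := inv_anti₀ hδ hε.1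
  have hinv0 : 0 < ε⁻¹ := inv_pos.2 hε0
  rw [affineDistribution_apply, norm_mul, Complex.norm_real, abs_of_pos hε0,
    Real.norm_of_nonneg (inv_nonneg.2 hε0.le)]
  have h1 := schwartzSup_affineComp_le K hinv0 (-(x₀ / ε)) ψ
  rw [abs_neg, abs_div, abs_of_pos hε0, one_div, inv_inv] at h1
  have h2 : |x₀| / ε ≤ |x₀| / δ := div_le_div_of_nonneg_left (abs_nonneg _) hδ hε.1
  have h3 : ε ≤ |ε₀| := hε.2.trans (le_abs_self _)
  calc ε⁻¹ * ‖f (affineComp ε⁻¹ (-(x₀ / ε)) ψ)‖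
      ≤ ε⁻¹ * (C * ((ε⁻¹ + ε) ^ (2 * K) * (1 + |x₀| / ε) ^ K * (2 ^ K * schwartzSup K ψ))) := by
        gcongr
        exact (hf _).trans (by gcongr)
    _ ≤ δ⁻¹ * (C * ((δ⁻¹ + |ε₀|) ^ (2 * K) * (1 + |x₀| / δ) ^ K * (2 ^ K * schwartzSup K ψ))) := by
        gcongr
    _ = _ := by ring

/-! ### Decay of wavelet coefficients -/

theorem norm_taylor_remainder_le (u : 𝓢(ℝ, ℂ)) (N : ℕ) (b h M : ℝ)
    (hM : ∀ t ∈ Set.Icc (0 : ℝ) 1, ‖iteratedDeriv (N + 1) u (b + t * h)‖ ≤ M) :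
    ‖u (b + h) - ∑ k ∈ Finset.range (N + 1),
      ((h ^ k : ℝ) : ℂ) * (((k.factorial : ℂ))⁻¹ * iteratedDeriv k u b)‖ ≤
        |h| ^ (N + 1) * M := by
  let g : ℝ → ℂ := fun t => u (b + t * h)
  have hg : ContDiff ℝ (⊤ : ℕ∞) g := u.smooth'.comp (by fun_prop)
  have hgd : ∀ k t, iteratedDeriv k g t = (h : ℂ) ^ k * iteratedDeriv k u (b + t * h) := by
    intro k
    induction k with
    | zero => intro t; simp [g]
    | succ k ih =>
      intro t
      have h1 : HasDerivAt (fun t : ℝ => b + t * h) h t := by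
        simpa using ((hasDerivAt_id t).mul_const h).const_add b
      have h3 := ((hasDerivAt_iteratedDeriv u k (b + t * h)).scomp t h1).const_mul ((h : ℂ) ^ k)
      rw [iteratedDeriv_succ, funext ih]
      refine h3.deriv.trans ?_
      rw [Complex.real_smul, pow_succ]
      ring
  have hw : ∀ k, ∀ t ∈ Set.Icc (0 : ℝ) 1,
      iteratedDerivWithin k g (Set.Icc 0 1) t = iteratedDeriv k g t := fun k t ht =>
    iteratedDerivWithin_eq_iteratedDeriv (uniqueDiffOn_Icc one_pos)
      ((hg.of_le (by exact_mod_cast le_top)).contDiffAt) ht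
  have key := taylor_mean_remainder_bound (f := g) (n := N) (C := |h| ^ (N + 1) * M) zero_le_one
    ((hg.of_le (by exact_mod_cast le_top)).contDiffOn) (Set.right_mem_Icc.2 zero_le_one)
    (fun t ht => by
      rw [hw _ t ht, hgd, norm_mul, norm_pow, Complex.norm_real, Real.norm_eq_abs]
      gcongr
      exact hM t ht)
  rw [taylor_within_apply] at key
  have hsum : ∑ k ∈ Finset.range (N + 1), ((k.factorial : ℝ)⁻¹ * (1 - 0 : ℝ) ^ k) •
      iteratedDerivWithin k g (Set.Icc 0 1) 0 = ∑ k ∈ Finset.range (N + 1),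
      ((h ^ k : ℝ) : ℂ) * (((k.factorial : ℂ))⁻¹ * iteratedDeriv k u b) := by
    refine Finset.sum_congr rfl fun k _ => ?_
    rw [hw k 0 (Set.left_mem_Icc.2 zero_le_one), hgd, Complex.real_smul]
    push_cast
    simp
    ring
  rw [hsum] at key
  have hM0 : 0 ≤ M := (norm_nonneg _).trans (hM 0 (by simp))
  simp only [g, one_mul, sub_zero, one_pow, mul_one] at key
  refine key.trans (div_le_self (by positivity) ?_)
  exact_mod_cast Nat.succ_le_of_lt (Nat.factorial_pos N)

/-- Decay of the overlap of a Schwartz function with a dilated Schwartz function having vanishing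
moments. -/
theorem exists_overlap_bound (u v : 𝓢(ℝ, ℂ)) (N R : ℕ)
    (hv : ∀ k ≤ N, schwartzMoment k v = 0) :
    ∃ C : ℝ, 0 ≤ C ∧ ∀ s b : ℝ, 0 < s → s ≤ 1 →
      ‖∫ x : ℝ, u (s * x + b) * v x‖ ≤ C * s ^ (N + 1) * ((1 + |b|) ^ R)⁻¹ := by
  set K := max R (N + 1)
  set D := 2 ^ K * schwartzSup K u
  have hD : 0 ≤ D := mul_nonneg (by positivity) (apply_nonneg _ _)
  let W : ℝ → ℝ := fun x => |x| ^ (N + 1) * (1 + |x|) ^ R * ‖v x‖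
  have hW : Integrable W := by
    have h1 := (v.integrable_pow_mul volume (N + 1)).const_mul (2 ^ (R - 1))
    have h2 := (v.integrable_pow_mul volume (N + 1 + R)).const_mul (2 ^ (R - 1))
    refine (h1.add h2).mono' ?_ (Eventually.of_forall fun x => ?_)
    · exact (Continuous.mul (by fun_prop) v.continuous.norm).aestronglyMeasurable
    · have hb := add_pow_le zero_le_one (abs_nonneg x) R
      rw [Real.norm_of_nonneg (by positivity)]
      simp only [W, Pi.add_apply, Real.norm_eq_abs]
      calc |x| ^ (N + 1) * (1 + |x|) ^ R * ‖v x‖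
          ≤ |x| ^ (N + 1) * (2 ^ (R - 1) * (1 ^ R + |x| ^ R)) * ‖v x‖ := by gcongr
        _ = _ := by rw [one_pow]; ring
  refine ⟨D * ∫ x, W x, mul_nonneg hD (integral_nonneg fun x => by positivity),
    fun s b hs hs1 => ?_⟩
  have hb0 : 0 < 1 + |b| := by positivity
  let a : ℕ → ℂ := fun k => ((s ^ k : ℝ) : ℂ) * ((k.factorial : ℂ)⁻¹ * iteratedDeriv k u b)
  have hint : Integrable fun x : ℝ => u (s * x + b) * v x := by
    refine (v.integrable (μ := volume)).bdd_mul (c := SchwartzMap.seminorm ℂ 0 0 u) ?_ ?_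
    · exact (u.continuous.comp (by fun_prop)).aestronglyMeasurable
    · exact Eventually.of_forall fun x => SchwartzMap.norm_le_seminorm ℂ u _
  have hsumint : Integrable fun x : ℝ =>
      ∑ k ∈ Finset.range (N + 1), a k * (((x ^ k : ℝ) : ℂ) * v x) :=
    integrable_finsetSum _ fun k _ => (integrable_pow_mul_schwartz k v).const_mul _
  have hsum0 : ∫ x : ℝ, ∑ k ∈ Finset.range (N + 1), a k * (((x ^ k : ℝ) : ℂ) * v x) = 0 := by
    rw [integral_finsetSum _ fun k _ => (integrable_pow_mul_schwartz k v).const_mul _]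
    refine Finset.sum_eq_zero fun k hk => ?_
    rw [integral_const_mul, ← schwartzMoment_apply,
      hv k (Nat.lt_succ_iff.1 (Finset.mem_range.1 hk)), mul_zero]
  -- The vanishing moments of v allow subtracting the Taylor polynomial of u at b, so only a
  -- remainder of order s^(N+1) is left.
  have heq : ∫ x : ℝ, u (s * x + b) * v x = ∫ x : ℝ, (u (s * x + b) * v x -
      ∑ k ∈ Finset.range (N + 1), a k * (((x ^ k : ℝ) : ℂ) * v x)) := by
    rw [integral_sub hint hsumint, hsum0, sub_zero]
  rw [heq]
  have hbound : ∀ x : ℝ, ‖u (s * x + b) * v x -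
      ∑ k ∈ Finset.range (N + 1), a k * (((x ^ k : ℝ) : ℂ) * v x)‖ ≤
        D * s ^ (N + 1) * ((1 + |b|) ^ R)⁻¹ * W x := by
    intro x
    have hM : ∀ t ∈ Set.Icc (0 : ℝ) 1, ‖iteratedDeriv (N + 1) u (b + t * (s * x))‖ ≤
        D * ((1 + |b|) ^ R)⁻¹ * (1 + |x|) ^ R := by
      intro t ht
      set y := b + t * (s * x)
      have h1 := one_add_pow_mul_le_schwartzSup (le_max_left R (N + 1)) (le_max_right R (N + 1)) u y
      -- A Peetre-type inequality, using s ≤ 1: decay of u at the intermediate point y becomes decay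
      -- in b at the cost of a weight in x, absorbed by v.
      have h2 : 1 + |b| ≤ (1 + |y|) * (1 + |x|) := by
        have h3 : |t * (s * x)| ≤ |x| := by
          rw [abs_mul, abs_mul, abs_of_nonneg ht.1, abs_of_pos hs, ← mul_assoc]
          exact mul_le_of_le_one_left (abs_nonneg _) (mul_le_one₀ ht.2 hs.le hs1)
        have h4 : |b| ≤ |y| + |t * (s * x)| := by
          have : b = y - t * (s * x) := by simp only [y]; ring
          rw [this]; exact abs_sub _ _
        nlinarith [abs_nonneg x, abs_nonneg y]
      have h5 := pow_le_pow_left₀ hb0.le h2 R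
      rw [mul_pow] at h5
      have h6 : (1 + |b|) ^ R * ‖iteratedDeriv (N + 1) u y‖ ≤ D * (1 + |x|) ^ R := by
        calc _ ≤ (1 + |y|) ^ R * (1 + |x|) ^ R * ‖iteratedDeriv (N + 1) u y‖ := by gcongr
          _ = (1 + |y|) ^ R * ‖iteratedDeriv (N + 1) u y‖ * (1 + |x|) ^ R := by ring
          _ ≤ _ := by gcongr
      calc ‖iteratedDeriv (N + 1) u y‖
          = ((1 + |b|) ^ R)⁻¹ * ((1 + |b|) ^ R * ‖iteratedDeriv (N + 1) u y‖) := by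
            field_simp
        _ ≤ ((1 + |b|) ^ R)⁻¹ * (D * (1 + |x|) ^ R) := by gcongr
        _ = _ := by ring
    have h7 := norm_taylor_remainder_le u N b (s * x) _ hM
    have h8 : u (s * x + b) * v x - ∑ k ∈ Finset.range (N + 1), a k * (((x ^ k : ℝ) : ℂ) * v x) =
        (u (b + s * x) - ∑ k ∈ Finset.range (N + 1),
          (((s * x) ^ k : ℝ) : ℂ) * ((k.factorial : ℂ)⁻¹ * iteratedDeriv k u b)) * v x := by
      rw [sub_mul, add_comm b, Finset.sum_mul]
      congr 1
      refine Finset.sum_congr rfl fun k _ => ?_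
      simp only [a, mul_pow]
      push_cast
      ring
    rw [h8, norm_mul]
    calc _ ≤ |s * x| ^ (N + 1) * (D * ((1 + |b|) ^ R)⁻¹ * (1 + |x|) ^ R) * ‖v x‖ := by gcongr
      _ = _ := by
        rw [abs_mul, abs_of_pos hs, mul_pow]
        simp only [W]
        ring
  refine (norm_integral_le_of_norm_le (hW.const_mul _) (Eventually.of_forall hbound)).trans ?_
  rw [integral_const_mul]
  exact le_of_eq (by ring)

/-- The coefficients of `ψ` with respect to the conjugate wavelets decay rapidly. -/
theorem exists_waveletCoeff_decay {φ : 𝓢(ℝ, ℂ)} (hφ : φ ∈ schwartzZero) (ψ : 𝓢(ℝ, ℂ)) (N R : ℕ)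
    (hψ : ∀ k ≤ N, schwartzMoment k ψ = 0) :
    ∃ C : ℝ, 0 ≤ C ∧ ∀ m n : ℤ, ‖∫ x : ℝ, ψ x * waveletFun φ m n x‖ ≤
      C * (((2 : ℝ) ^ m + 1 / (2 : ℝ) ^ m) ^ N)⁻¹ * ((1 + |(n : ℝ)|) ^ R)⁻¹ := by
  have hφ' : ∀ k, schwartzMoment k φ = 0 := fun k => by rw [schwartzMoment_apply]; exact hφ k
  obtain ⟨C₁, hC₁, h₁⟩ := exists_overlap_bound φ ψ N R hψ
  -- When the dilation falls on ψ the shift becomes n/2^m. Recovering decay in n costs a factor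
  -- 2^(mR), paid for by R further vanishing moments of φ.
  obtain ⟨C₂, hC₂, h₂⟩ := exists_overlap_bound ψ φ (N + R) R fun k _ => hφ' k
  refine ⟨2 ^ N * max C₁ C₂, by positivity, fun m n => ?_⟩
  have hn0 : 0 < 1 + |(n : ℝ)| := by positivity
  -- Here s = min(2^m, 2^(-m)): the dilation is put on whichever function makes its factor at most
  -- 1.
  suffices h : ∃ s : ℝ, 0 < s ∧ s ≤ 1 ∧ s + 1 / s = (2 : ℝ) ^ m + 1 / (2 : ℝ) ^ m ∧
      ‖∫ x : ℝ, ψ x * waveletFun φ m n x‖ ≤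
        max C₁ C₂ * s ^ (N + 1) * ((1 + |(n : ℝ)|) ^ R)⁻¹ by
    obtain ⟨s, hs, hs1, hκ, hb⟩ := h
    have h4 : s ^ (N + 1) ≤ 2 ^ N * (((2 : ℝ) ^ m + 1 / (2 : ℝ) ^ m) ^ N)⁻¹ := by
      have h5 : s ≤ 2 * (s + 1 / s)⁻¹ := by
        rw [← div_eq_mul_inv, le_div_iff₀ (by positivity), mul_add, mul_one_div_cancel hs.ne']
        nlinarith
      calc s ^ (N + 1) ≤ s ^ N := pow_le_pow_of_le_one hs.le hs1 (Nat.le_succ N)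
        _ ≤ (2 * (s + 1 / s)⁻¹) ^ N := by gcongr
        _ = _ := by rw [mul_pow, inv_pow, hκ]
    have hC : 0 ≤ max C₁ C₂ := hC₁.trans (le_max_left _ _)
    calc _ ≤ _ := hb
      _ ≤ max C₁ C₂ * (2 ^ N * (((2 : ℝ) ^ m + 1 / (2 : ℝ) ^ m) ^ N)⁻¹) *
          ((1 + |(n : ℝ)|) ^ R)⁻¹ := by gcongr
      _ = _ := by ring
  have h2m : (0 : ℝ) < 2 ^ m := by positivity
  have hhalf : (0 : ℝ) < (2 : ℝ) ^ ((m : ℝ) / 2) := by positivity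
  have hnorm : ‖∫ x : ℝ, ψ x * waveletFun φ m n x‖ =
      (2 : ℝ) ^ ((m : ℝ) / 2) * ‖∫ x : ℝ, φ ((2 : ℝ) ^ m * x + -(n : ℝ)) * ψ x‖ := by
    rw [← Real.norm_of_nonneg hhalf.le, ← Complex.norm_real, ← norm_mul, ← integral_const_mul]
    congr 1
    refine integral_congr_ae (Eventually.of_forall fun x => ?_)
    simp only [waveletFun_apply, sub_eq_add_neg]
    ring
  rw [hnorm]
  rcases le_total m 0 with hm | hm
  · have hs1 : (2 : ℝ) ^ m ≤ 1 := zpow_le_one_of_nonpos₀ (by norm_num) hm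
    refine ⟨2 ^ m, h2m, hs1, rfl, ?_⟩
    have h3 := h₁ (2 ^ m) (-(n : ℝ)) h2m hs1
    rw [abs_neg] at h3
    have h4 : (2 : ℝ) ^ ((m : ℝ) / 2) ≤ 1 := by
      apply Real.rpow_le_one_of_one_le_of_nonpos (by norm_num)
      have : (m : ℝ) ≤ 0 := by exact_mod_cast hm
      linarith
    calc _ ≤ 1 * (C₁ * (2 ^ m) ^ (N + 1) * ((1 + |(n : ℝ)|) ^ R)⁻¹) := by gcongr
      _ ≤ _ := by rw [one_mul]; gcongr; exact le_max_left _ _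
  · have hs : (0 : ℝ) < (2 ^ m)⁻¹ := by positivity
    have hs1 : ((2 : ℝ) ^ m)⁻¹ ≤ 1 := inv_le_one_of_one_le₀ (one_le_zpow₀ (by norm_num) hm)
    refine ⟨((2 : ℝ) ^ m)⁻¹, hs, hs1, by rw [one_div, inv_inv, one_div, add_comm], ?_⟩
    set s := ((2 : ℝ) ^ m)⁻¹
    have hcv : ∫ x : ℝ, φ ((2 : ℝ) ^ m * x + -(n : ℝ)) * ψ x =
        (s : ℂ) * ∫ y : ℝ, ψ (s * y + s * n) * φ y := by
      have e1 := Measure.integral_comp_mul_left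
        (fun y : ℝ => φ (y + -(n : ℝ)) * ψ (s * y)) ((2 : ℝ) ^ m)
      have e2 : ∀ x : ℝ, s * ((2 : ℝ) ^ m * x) = x := fun x => by simp only [s]; field_simp
      simp only [e2] at e1
      have e3 := integral_add_right_eq_self (μ := (volume : Measure ℝ))
        (fun y : ℝ => φ (y + -(n : ℝ)) * ψ (s * y)) (n : ℝ)
      rw [e1, ← e3, abs_of_pos hs, Complex.real_smul]
      congr 1
      refine integral_congr_ae (Eventually.of_forall fun x => ?_)
      simp only [add_neg_cancel_right, mul_add]
      ring
    rw [hcv, norm_mul, Complex.norm_real, Real.norm_of_nonneg hs.le, ← mul_assoc]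
    have h3 := h₂ s (s * n) hs hs1
    have h4 : (2 : ℝ) ^ ((m : ℝ) / 2) * s ≤ 1 := by
      rw [← div_eq_mul_inv, div_le_one h2m, ← Real.rpow_intCast]
      apply Real.rpow_le_rpow_of_exponent_le (by norm_num)
      have : (0 : ℝ) ≤ m := by exact_mod_cast hm
      linarith
    have h5 : ((1 + |s * n|) ^ R)⁻¹ ≤ (s ^ R)⁻¹ * ((1 + |(n : ℝ)|) ^ R)⁻¹ := by
      rw [← mul_inv, ← mul_pow]
      refine inv_anti₀ (by positivity) (pow_le_pow_left₀ (by positivity) ?_ R)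
      rw [abs_mul, abs_of_pos hs]
      linarith
    calc _ ≤ 1 * (C₂ * s ^ (N + R + 1) * ((s ^ R)⁻¹ * ((1 + |(n : ℝ)|) ^ R)⁻¹)) := by
          gcongr
          exact h3.trans (by gcongr)
      _ = C₂ * s ^ (N + 1) * ((1 + |(n : ℝ)|) ^ R)⁻¹ := by
          rw [show N + R + 1 = N + 1 + R by ring, pow_add s (N + 1) R]
          field_simp
      _ ≤ _ := by gcongr; exact le_max_right _ _

/-! ### Wavelet expansions tested against tempered distributions -/

theorem summable_wavelet_weight :
    Summable fun p : ℤ × ℤ =>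
      ((2 : ℝ) ^ p.1 + 1 / (2 : ℝ) ^ p.1)⁻¹ * ((1 + |(p.2 : ℝ)|) ^ 2)⁻¹ := by
  have hgeo : Summable fun k : ℕ => (1 / 2 : ℝ) ^ k :=
    summable_geometric_of_lt_one (by norm_num) (by norm_num)
  have h1 : Summable fun m : ℤ => ((2 : ℝ) ^ m + 1 / (2 : ℝ) ^ m)⁻¹ := by
    refine Summable.of_nat_of_neg ?_ ?_
    · refine hgeo.of_nonneg_of_le (fun k => by positivity) fun k => ?_
      rw [one_div_pow, one_div ((2 : ℝ) ^ k)]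
      refine inv_anti₀ (by positivity) ?_
      rw [zpow_natCast]
      exact le_add_of_nonneg_right (by positivity)
    · refine hgeo.of_nonneg_of_le (fun k => by positivity) fun k => ?_
      rw [one_div_pow, one_div ((2 : ℝ) ^ k)]
      refine inv_anti₀ (by positivity) ?_
      rw [zpow_neg, zpow_natCast, one_div, inv_inv]
      exact le_add_of_nonneg_left (by positivity)
  have hsq : Summable fun k : ℕ => ((1 + (k : ℝ)) ^ 2)⁻¹ := by
    have := (summable_nat_add_iff 1).2 (Real.summable_nat_pow_inv.2 one_lt_two)
    refine this.congr fun k => ?_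
    push_cast
    rw [add_comm]
  have h2 : Summable fun n : ℤ => ((1 + |(n : ℝ)|) ^ 2)⁻¹ := by
    refine Summable.of_nat_of_neg ?_ ?_
    · exact hsq.congr fun k => by simp
    · exact hsq.congr fun k => by simp
  exact h1.mul_of_nonneg h2 (fun m => by positivity) (fun n => by positivity)

section Expansion

variable {ι : Type*} {F : ι → 𝓢(ℝ, ℂ)} {χ : 𝓢(ℝ, ℂ)}

/-- An `L²`-convergent series of Schwartz functions that converges uniformly also converges
pointwise to the same sum. -/
theorem hasSum_apply_of_hasSum_toLp [Countable ι] (hL2 : HasSum (fun i => (F i).toLp 2) (χ.toLp 2))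
    (hF : Summable fun i => schwartzSup 0 (F i)) (x : ℝ) : HasSum (fun i => F i x) (χ x) := by
  have hb : ∀ i y, ‖F i y‖ ≤ schwartzSup 0 (F i) := fun i y => by
    simpa using one_add_pow_mul_le_schwartzSup (le_refl 0) (le_refl 0) (F i) y
  have hs : ∀ y, Summable fun i => F i y := fun y => hF.of_norm_bounded fun i => hb i y
  have hcont : Continuous fun y => ∑' i, F i y :=
    continuous_tsum (fun i => (F i).continuous) hF hb
  obtain ⟨ns, hns, hae⟩ :=
    (tendstoInMeasure_of_tendsto_Lp (μ := (volume : Measure ℝ)) hL2).exists_seq_tendsto_ae'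
  have hfin : ∀ J : Finset ι, ∀ᵐ y : ℝ,
      ((∑ i ∈ J, (F i).toLp 2 : Lp ℂ 2 (volume : Measure ℝ)) : ℝ → ℂ) y = ∑ i ∈ J, F i y := by
    classical
    intro J
    induction J using Finset.induction_on with
    | empty =>
      filter_upwards [Lp.coeFn_zero ℂ 2 (volume : Measure ℝ)] with y hy
      rw [Finset.sum_empty, hy, Finset.sum_empty, Pi.zero_apply]
    | insert i J hi ih =>
      rw [Finset.sum_insert hi]
      filter_upwards [ih, (F i).coeFn_toLp 2 volume,
        Lp.coeFn_add ((F i).toLp 2 volume) (∑ i ∈ J, (F i).toLp 2 volume)] with y h1 h2 h3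
      rw [h3, Pi.add_apply, h1, h2, Finset.sum_insert hi]
  -- An a.e. convergent sequence of partial sums identifies the uniform limit with χ almost
  -- everywhere; continuity of both removes the exceptional set.
  have heq : (fun y => ∑' i, F i y) =ᵐ[volume] χ := by
    filter_upwards [hae, χ.coeFn_toLp 2 volume, ae_all_iff.2 hfin] with y h1 h2 h3
    refine tendsto_nhds_unique ((hs y).hasSum.comp hns) ?_
    rw [← h2]
    exact h1.congr fun k => h3 _
  have := (hcont.ae_eq_iff_eq volume χ.continuous).1 heq
  rw [← congrFun this x]
  exact (hs x).hasSum

theorem hasSum_iteratedDeriv {K : ℕ} (hpt : ∀ x, HasSum (fun i => F i x) (χ x))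
    (hF : Summable fun i => schwartzSup K (F i)) {n : ℕ} (hn : n ≤ K) (x : ℝ) :
    HasSum (fun i => iteratedDeriv n (F i) x) (iteratedDeriv n χ x) := by
  have hb : ∀ n ≤ K, ∀ i y, ‖iteratedDeriv n (F i) y‖ ≤ 2 ^ K * schwartzSup K (F i) :=
    fun n hn i y => by
      simpa using one_add_pow_mul_le_schwartzSup (Nat.zero_le K) hn (F i) y
  have hu := hF.mul_left (2 ^ K)
  induction n generalizing x with
  | zero => simpa using hpt x
  | succ n ih =>
    have ih' := ih (Nat.le_of_succ_le hn)
    have h1 := hasDerivAt_tsum (y₀ := x) hu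
      (fun i y => hasDerivAt_iteratedDeriv (F i) n y) (hb (n + 1) hn) (ih' x).summable x
    have h2 : (fun z => ∑' i, iteratedDeriv n (F i) z) = iteratedDeriv n χ :=
      funext fun z => (ih' z).tsum_eq
    rw [h2] at h1
    rw [(hasDerivAt_iteratedDeriv χ n x).unique h1]
    exact (hu.of_norm_bounded fun i => hb (n + 1) hn i x).hasSum

/-- Since T sees only one seminorm, convergence of the partial sums in that seminorm suffices; its
tail is bounded by the tail of the summed seminorms, after termwise differentiation. -/
theorem hasSum_functional {K : ℕ} {C : ℝ} (T : 𝓢(ℝ, ℂ) →L[ℂ] ℂ)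
    (hT : ∀ ψ, ‖T ψ‖ ≤ C * schwartzSup K ψ) (hpt : ∀ x, HasSum (fun i => F i x) (χ x))
    (hF : Summable fun i => schwartzSup K (F i)) : HasSum (fun i => T (F i)) (T χ) := by
  have hu := hF.mul_left (2 ^ K)
  have hC : 0 ≤ |C| := abs_nonneg C
  have hrem : ∀ J : Finset ι, schwartzSup K (χ - ∑ i ∈ J, F i) ≤
      ∑' i : { i // i ∉ J }, 2 ^ K * schwartzSup K (F i) := by
    intro J
    refine schwartzSup_le (tsum_nonneg fun i => mul_nonneg (by positivity) (apply_nonneg _ _))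
      fun k hk n hn x => ?_
    have h1 : iteratedDeriv n (χ - ∑ i ∈ J, F i) x =
        iteratedDeriv n χ x - ∑ i ∈ J, iteratedDeriv n (F i) x := by
      rw [iteratedDeriv_sub_apply]
      congr 1
      rw [← iteratedDeriv_fun_sum fun i _ => ((F i).smooth n).contDiffAt]
      congr 1
      ext y
      simp
    have h2 : HasSum (fun i : { i // i ∉ J } => iteratedDeriv n (F i) x)
        (iteratedDeriv n χ x - ∑ i ∈ J, iteratedDeriv n (F i) x) := by
      rw [Finset.hasSum_compl_iff (f := fun i => iteratedDeriv n (F i) x), sub_add_cancel]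
      exact hasSum_iteratedDeriv hpt hF hn x
    have h3 := h2.mul_left ((|x| ^ k : ℝ) : ℂ)
    have h4 := h3.norm_le_of_bounded (hu.subtype _).hasSum fun i => by
      rw [norm_mul, Complex.norm_real, Real.norm_of_nonneg (by positivity)]
      refine le_trans ?_ (one_add_pow_mul_le_schwartzSup hk hn (F i) x)
      gcongr
      linarith
    rw [norm_mul, Complex.norm_real, Real.norm_of_nonneg (by positivity), ← h1] at h4
    exact h4
  rw [HasSum, SummationFilter.unconditional_filter, tendsto_iff_norm_sub_tendsto_zero]
  have hz := (tendsto_tsum_compl_atTop_zero fun i => 2 ^ K * schwartzSup K (F i)).const_mul |C|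
  rw [mul_zero] at hz
  refine squeeze_zero (fun J => norm_nonneg _) (fun J => ?_) hz
  rw [norm_sub_rev, ← map_sum, ← map_sub]
  calc _ ≤ C * schwartzSup K (χ - ∑ i ∈ J, F i) := hT _
    _ ≤ |C| * schwartzSup K (χ - ∑ i ∈ J, F i) :=
        mul_le_mul_of_nonneg_right (le_abs_self C) (apply_nonneg _ _)
    _ ≤ _ := mul_le_mul_of_nonneg_left (hrem J) hC

end Expansion

theorem toLp_waveletFun_eq {φ : 𝓢(ℝ, ℂ)} {b : HilbertBasis (ℤ × ℤ) ℂ (Lp ℂ 2 (volume : Measure ℝ))}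
    (hb : ∀ m n : ℤ, (b (m, n) : ℝ → ℂ) =ᵐ[volume]
      fun x : ℝ => (((2 : ℝ) ^ ((m : ℝ) / 2) : ℝ) : ℂ) * φ ((2 : ℝ) ^ m * x - n)) (p : ℤ × ℤ) :
    b p = (waveletFun φ p.1 p.2).toLp 2 volume := by
  refine Lp.ext ?_
  filter_upwards [hb p.1 p.2, (waveletFun φ p.1 p.2).coeFn_toLp 2 volume] with x h1 h2
  rw [h2, waveletFun_apply]
  exact h1

/-- The `L²`-expansion of a Schwartz function in the wavelet basis. -/
theorem hasSum_toLp_wavelet {φ : 𝓢(ℝ, ℂ)} (hφ : IsOrthonormalWavelet φ) (ψ : 𝓢(ℝ, ℂ)) :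
    HasSum (fun p : ℤ × ℤ => ((starRingEnd ℂ (∫ x : ℝ, ψ x * waveletFun φ p.1 p.2 x)) •
      waveletFun φ p.1 p.2).toLp 2 (volume : Measure ℝ)) ((schwartzConj ψ).toLp 2 volume) := by
  obtain ⟨b, hb⟩ := hφ
  refine (b.hasSum_repr ((schwartzConj ψ).toLp 2 volume)).congr_fun fun p => ?_
  have h1 : b.repr ((schwartzConj ψ).toLp 2 volume) p =
      starRingEnd ℂ (∫ x : ℝ, ψ x * waveletFun φ p.1 p.2 x) := by
    rw [HilbertBasis.repr_apply_apply, toLp_waveletFun_eq hb, SchwartzMap.inner_toL2_toL2_eq _ _ volume,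
      ← integral_conj]
    refine integral_congr_ae (Eventually.of_forall fun x => ?_)
    simp only [schwartzConj_apply, RCLike.inner_apply, map_mul]
  rw [h1, toLp_waveletFun_eq hb]
  exact ((SchwartzMap.toLpCLM ℂ ℂ 2 (volume : Measure ℝ)).map_smul _ _).symm

/-- Wavelet expansion, tested against a tempered distribution, of a Schwartz function with
sufficiently many vanishing moments. -/
theorem hasSum_wavelet_expansion {φ : 𝓢(ℝ, ℂ)} (hφ₀ : φ ∈ schwartzZero)
    (hφ : IsOrthonormalWavelet φ) {K N : ℕ} (hN : 2 * K + 2 ≤ N) {C : ℝ} (T : 𝓢(ℝ, ℂ) →L[ℂ] ℂ)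
    (hT : ∀ ψ, ‖T ψ‖ ≤ C * schwartzSup K ψ) {ψ : 𝓢(ℝ, ℂ)}
    (hψ : ∀ k ≤ N, schwartzMoment k ψ = 0) :
    HasSum (fun p : ℤ × ℤ => (∫ x : ℝ, ψ x * waveletFun φ p.1 p.2 x) *
      T (schwartzConj (waveletFun φ p.1 p.2))) (T ψ) := by
  set a : ℤ × ℤ → ℂ := fun p => ∫ x : ℝ, ψ x * waveletFun φ p.1 p.2 x
  obtain ⟨D, hD, hdec⟩ := exists_waveletCoeff_decay hφ₀ ψ N (K + 2) hψ
  have hsum : ∀ η : 𝓢(ℝ, ℂ), ∀ K' ≤ K,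
      Summable fun p : ℤ × ℤ => ‖a p‖ * schwartzSup K' (waveletFun η p.1 p.2) := by
    intro η K' hK'
    have hη : 0 ≤ schwartzSup K η := apply_nonneg _ _
    refine (summable_wavelet_weight.mul_left (D * (2 ^ K * schwartzSup K η))).of_nonneg_of_le
      (fun p => mul_nonneg (norm_nonneg _) (apply_nonneg _ _)) fun p => ?_
    set κ := (2 : ℝ) ^ p.1 + 1 / (2 : ℝ) ^ p.1
    have hκ : 1 ≤ κ := one_le_add_inv (by positivity)
    have hκ0 : 0 < κ := one_pos.trans_le hκ
    have hn0 : 0 < 1 + |(p.2 : ℝ)| := by positivity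
    have h1 : (κ ^ N)⁻¹ ≤ (κ ^ (2 * K + 2))⁻¹ :=
      inv_anti₀ (by positivity) (pow_le_pow_right₀ hκ hN)
    calc ‖a p‖ * schwartzSup K' (waveletFun η p.1 p.2)
        ≤ (D * (κ ^ (2 * K + 2))⁻¹ * ((1 + |(p.2 : ℝ)|) ^ (K + 2))⁻¹) *
          (κ ^ (2 * K + 1) * (1 + |(p.2 : ℝ)|) ^ K * (2 ^ K * schwartzSup K η)) := by
          refine mul_le_mul ((hdec p.1 p.2).trans (by gcongr))
            ((schwartzSup_mono hK' _).trans (schwartzSup_waveletFun_le K η p.1 p.2))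
            (apply_nonneg _ _) (by positivity)
      _ = _ := by
          rw [pow_succ κ (2 * K + 1), pow_add _ K 2]
          field_simp
  -- The basis expands the conjugate of ψ in the wavelets; conjugating that series expands ψ in the
  -- conjugate wavelets, the functions that T is tested on.
  have hpt : ∀ x, HasSum (fun p => (a p • schwartzConj (waveletFun φ p.1 p.2)) x) (ψ x) := by
    intro x
    have h1 := hasSum_apply_of_hasSum_toLp (hasSum_toLp_wavelet hφ ψ) (by
      refine (hsum φ 0 (Nat.zero_le K)).congr fun p => ?_
      rw [map_smul_eq_mul, RCLike.norm_conj]) x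
    have h2 := h1.map (starRingEnd ℂ) Complex.continuous_conj
    rw [schwartzConj_apply, Complex.conj_conj] at h2
    refine h2.congr_fun fun p => ?_
    simp [a, schwartzConj_apply]
  have := hasSum_functional T hT hpt (by
    refine (hsum (schwartzConj φ) K le_rfl).congr fun p => ?_
    rw [map_smul_eq_mul, schwartzConj_waveletFun])
  simpa using this

/-! ### Dilations, functions dual to the moments, and polynomials -/

/-- The `L¹`-normalized dilation `ψ ↦ a⁻¹ ψ(· / a)`. -/
def schwartzDilate (a : ℝ) : 𝓢(ℝ, ℂ) →L[ℂ] 𝓢(ℝ, ℂ) :=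
  ((a⁻¹ : ℝ) : ℂ) • affineComp a⁻¹ 0

theorem schwartzDilate_apply {a : ℝ} (ha : 0 < a) (ψ : 𝓢(ℝ, ℂ)) (x : ℝ) :
    schwartzDilate a ψ x = ((a⁻¹ : ℝ) : ℂ) * ψ (a⁻¹ * x) := by
  simp [schwartzDilate, affineComp_apply (inv_pos.2 ha).ne']

theorem schwartzMoment_dilate {a : ℝ} (ha : 0 < a) (k : ℕ) (ψ : 𝓢(ℝ, ℂ)) :
    schwartzMoment k (schwartzDilate a ψ) = ((a ^ k : ℝ) : ℂ) * schwartzMoment k ψ := by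
  change schwartzMoment k (((a⁻¹ : ℝ) : ℂ) • affineComp a⁻¹ 0 ψ) = _
  have ha' : (a : ℂ) ≠ 0 := by exact_mod_cast ha.ne'
  rw [map_smul, schwartzMoment_affineComp (inv_pos.2 ha), smul_eq_mul, inv_inv]
  push_cast
  field_simp
  ring

theorem affineDistribution_mul (f : 𝓢'(ℝ, ℂ)) (x₀ : ℝ) {a ε : ℝ} (ha : 0 < a) (hε : 0 < ε)
    (ψ : 𝓢(ℝ, ℂ)) :
    affineDistribution f x₀ (a * ε) ψ = affineDistribution f x₀ ε (schwartzDilate a ψ) := by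
  rw [affineDistribution_apply, affineDistribution_apply]
  have h : affineComp ε⁻¹ (-(x₀ / ε)) (schwartzDilate a ψ) =
      ((a⁻¹ : ℝ) : ℂ) • affineComp (a * ε)⁻¹ (-(x₀ / (a * ε))) ψ := by
    ext x
    rw [affineComp_apply (inv_pos.2 hε).ne', schwartzDilate_apply ha, _root_.smul_apply,
      affineComp_apply (inv_pos.2 (mul_pos ha hε)).ne', smul_eq_mul]
    congr 2
    field_simp
  rw [h, map_smul, smul_eq_mul, abs_of_pos (mul_pos ha hε), abs_of_pos hε]
  push_cast
  rw [mul_inv]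
  ring

theorem affineDistribution_zero_apply (g : 𝓢'(ℝ, ℂ)) {a : ℝ} (ha : 0 < a) (ψ : 𝓢(ℝ, ℂ)) :
    affineDistribution g 0 a ψ = g (schwartzDilate a ψ) := by
  rw [affineDistribution_apply, zero_div, neg_zero, abs_of_pos ha]
  change _ = g (((a⁻¹ : ℝ) : ℂ) • affineComp a⁻¹ 0 ψ)
  rw [map_smul, smul_eq_mul]

theorem schwartzMoment_derivCLM (k : ℕ) (ψ : 𝓢(ℝ, ℂ)) :
    schwartzMoment k (SchwartzMap.derivCLM ℂ ℂ ψ) = -(k : ℂ) * schwartzMoment (k - 1) ψ := by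
  simp only [schwartzMoment_apply]
  have hd : ∀ x : ℝ, HasDerivAt (fun x : ℝ => ((x ^ k : ℝ) : ℂ))
      ((k : ℂ) * ((x ^ (k - 1) : ℝ) : ℂ)) x := fun x => by
    have := (hasDerivAt_pow k x).ofReal_comp
    simpa using this
  have := integral_mul_deriv_eq_deriv_mul_of_integrable
    (u := fun x : ℝ => ((x ^ k : ℝ) : ℂ)) (u' := fun x : ℝ => (k : ℂ) * ((x ^ (k - 1) : ℝ) : ℂ))
    (v := ψ) (v' := SchwartzMap.derivCLM ℂ ℂ ψ) (fun x _ => hd x)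
    (fun x _ => ψ.hasDerivAt x) (integrable_pow_mul_schwartz k _)
    (((integrable_pow_mul_schwartz (k - 1) ψ).const_mul (k : ℂ)).congr
      (Eventually.of_forall fun x => by simp [mul_assoc])) (integrable_pow_mul_schwartz k ψ)
  rw [this, ← integral_const_mul, ← integral_neg]
  refine integral_congr_ae (Eventually.of_forall fun x => ?_)
  ring

/-- Integration by parts sends the (k−1)-st moment, up to the factor −k, to the k-th moment of the
derivative; a normalized bump is differentiated N times. -/
theorem exists_moment_dual (N : ℕ) :
    ∃ ρ : 𝓢(ℝ, ℂ), (∀ k < N, schwartzMoment k ρ = 0) ∧ schwartzMoment N ρ = 1 := by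
  induction N with
  | zero =>
    let b : ContDiffBump (0 : ℝ) := ⟨1, 2, one_pos, one_lt_two⟩
    have hs : HasCompactSupport fun x : ℝ => ((b x : ℝ) : ℂ) :=
      b.hasCompactSupport.comp_left (g := fun y : ℝ => (y : ℂ)) Complex.ofReal_zero
    have hc : ContDiff ℝ (⊤ : ℕ∞) fun x : ℝ => ((b x : ℝ) : ℂ) :=
      Complex.ofRealCLM.contDiff.comp b.contDiff
    let η : 𝓢(ℝ, ℂ) := hs.toSchwartzMap hc
    have hη : schwartzMoment 0 η = ((∫ x, b x : ℝ) : ℂ) := by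
      rw [schwartzMoment_apply, ← integral_complex_ofReal]
      refine integral_congr_ae (Eventually.of_forall fun x => ?_)
      simp [η]
    have hne : ((∫ x, b x : ℝ) : ℂ) ≠ 0 := by exact_mod_cast (b.integral_pos (μ := volume)).ne'
    refine ⟨((∫ x, b x : ℝ) : ℂ)⁻¹ • η, by simp, ?_⟩
    rw [map_smul, hη, smul_eq_mul, inv_mul_cancel₀ hne]
  | succ N ih =>
    obtain ⟨ρ, h0, h1⟩ := ih
    refine ⟨(-((N + 1 : ℕ) : ℂ))⁻¹ • SchwartzMap.derivCLM ℂ ℂ ρ, fun k hk => ?_, ?_⟩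
    · rw [map_smul, schwartzMoment_derivCLM]
      rcases k with _ | k
      · simp
      · rw [Nat.add_sub_cancel, h0 k (Nat.succ_lt_succ_iff.1 hk), mul_zero, smul_zero]
    · rw [map_smul, schwartzMoment_derivCLM, Nat.add_sub_cancel, h1, mul_one, smul_eq_mul]
      refine inv_mul_cancel₀ (neg_ne_zero.2 ?_)
      exact_mod_cast Nat.succ_ne_zero N

theorem integral_polynomial_eq_sum (p : Polynomial ℂ) {N : ℕ} (hN : p.natDegree < N) (ε : ℝ)
    (ψ : 𝓢(ℝ, ℂ)) : ∫ x : ℝ, p.eval ((ε * x : ℝ) : ℂ) * ψ x =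
      ∑ k ∈ Finset.range N, p.coeff k * (ε : ℂ) ^ k * schwartzMoment k ψ := by
  have h : ∀ x : ℝ, p.eval ((ε * x : ℝ) : ℂ) * ψ x =
      ∑ k ∈ Finset.range N, p.coeff k * (ε : ℂ) ^ k * (((x ^ k : ℝ) : ℂ) * ψ x) := by
    intro x
    rw [Polynomial.eval_eq_sum_range' hN, Finset.sum_mul]
    refine Finset.sum_congr rfl fun k _ => ?_
    push_cast
    ring
  simp only [h]
  rw [integral_finsetSum _ fun k _ => (integrable_pow_mul_schwartz k ψ).const_mul _]
  refine Finset.sum_congr rfl fun k _ => ?_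
  rw [integral_const_mul, schwartzMoment_apply]

theorem schwartzMoment_affineComp_eq_zero {φ : 𝓢(ℝ, ℂ)} (hφ : φ ∈ schwartzZero) {c : ℝ}
    (hc : c ≠ 0) (b : ℝ) (k : ℕ) : schwartzMoment k (affineComp c b φ) = 0 := by
  have hφ' : ∀ k, schwartzMoment k φ = 0 := fun k => by rw [schwartzMoment_apply]; exact hφ k
  rw [schwartzMoment_apply]
  have e1 := Measure.integral_comp_mul_left
    (fun y : ℝ => (((c⁻¹ * y) ^ k : ℝ) : ℂ) * φ (y + b)) c
  have e2 : ∀ x : ℝ, c⁻¹ * (c * x) = x := fun x => by field_simp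
  simp only [e2] at e1
  have e3 := integral_add_right_eq_self (μ := (volume : Measure ℝ))
    (fun y : ℝ => (((c⁻¹ * (y - b)) ^ k : ℝ) : ℂ) * φ y) b
  simp only [add_sub_cancel_right] at e3
  simp only [affineComp_apply hc]
  rw [e1, e3]
  let p : Polynomial ℂ := (Polynomial.C ((c⁻¹ : ℝ) : ℂ) * (Polynomial.X - Polynomial.C (b : ℂ))) ^ k
  have e4 := integral_polynomial_eq_sum p (Nat.lt_succ_self _) 1 φ
  simp only [hφ', mul_zero, Finset.sum_const_zero] at e4
  rw [smul_eq_zero]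
  right
  rw [← e4]
  refine integral_congr_ae (Eventually.of_forall fun x => ?_)
  simp [p]

theorem schwartzMoment_conj_waveletFun {φ : 𝓢(ℝ, ℂ)} (hφ : φ ∈ schwartzZero) (m n : ℤ) (k : ℕ) :
    schwartzMoment k (schwartzConj (waveletFun φ m n)) = 0 := by
  have hφ' : schwartzConj φ ∈ schwartzZero := fun k => by
    have := congrArg (starRingEnd ℂ) (hφ k)
    rw [← integral_conj, map_zero] at this
    rw [← this]
    refine integral_congr_ae (Eventually.of_forall fun x => ?_)
    simp only [schwartzConj_apply, map_mul, Complex.conj_ofReal]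
  have h2 : (2 : ℝ) ^ m ≠ 0 := by positivity
  rw [schwartzConj_waveletFun, waveletFun, map_smul,
    schwartzMoment_affineComp_eq_zero hφ' h2, smul_zero]

/-! ### Removing the vanishing-moment conditions -/

section MomentReduction

variable {L : ℝ → ℝ} {A α ε₁ : ℝ} {T : ℝ → 𝓢(ℝ, ℂ) →L[ℂ] ℂ}

/-- The ratios `T ε ψ / (ε ^ α L(ε))` converge for all `ψ` whose first `N` moments vanish. -/
def ConvergesOnMoments (T : ℝ → 𝓢(ℝ, ℂ) →L[ℂ] ℂ) (α : ℝ) (L : ℝ → ℝ) (N : ℕ) : Prop :=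
  ∀ ψ : 𝓢(ℝ, ℂ), (∀ k < N, schwartzMoment k ψ = 0) →
    ∃ l, Tendsto (fun ε : ℝ => T ε ψ / ((ε ^ α * L ε : ℝ) : ℂ)) (𝓝[>] 0) (𝓝 l)

theorem IsSlowlyVaryingAtZero.tendsto_rpow_mul_ratio (hL : IsSlowlyVaryingAtZero L A) (τ : ℝ)
    {a : ℝ} (ha : 0 < a) :
    Tendsto (fun ε => ((a * ε) ^ τ * L (a * ε)) / (ε ^ τ * L ε)) (𝓝[>] 0) (𝓝 (a ^ τ)) := by
  have h := (hL.ratio a ha).const_mul (a ^ τ)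
  rw [mul_one] at h
  refine h.congr' ?_
  filter_upwards [self_mem_nhdsWithin] with ε hε
  have hε' : 0 < ε ^ τ := Real.rpow_pos_of_pos hε τ
  rw [Real.mul_rpow ha.le (le_of_lt hε)]
  field_simp

theorem rpow_mul_bounded_below (τ : ℝ)
    (hlow : ∀ δ ∈ Set.Ioc 0 ε₁, ∃ c : ℝ, 0 < c ∧ ∀ ε ∈ Set.Icc δ ε₁, c ≤ L ε) :
    ∀ δ ∈ Set.Ioc 0 ε₁, ∃ c : ℝ, 0 < c ∧ ∀ ε ∈ Set.Icc δ ε₁, c ≤ ε ^ τ * L ε := by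
  intro δ hδ
  obtain ⟨c, hc, h⟩ := hlow δ hδ
  have h1 : 0 < min (δ ^ τ) (ε₁ ^ τ) := lt_min (Real.rpow_pos_of_pos hδ.1 _)
    (Real.rpow_pos_of_pos (hδ.1.trans_le hδ.2) _)
  refine ⟨min (δ ^ τ) (ε₁ ^ τ) * c, mul_pos h1 hc, fun ε hε => ?_⟩
  have hε0 : 0 < ε := hδ.1.trans_le hε.1
  refine mul_le_mul ?_ (h ε hε) hc.le (Real.rpow_nonneg hε0.le _)
  rcases le_total 0 τ with hτ | hτ
  · exact (min_le_left _ _).trans (Real.rpow_le_rpow hδ.1.le hε.1 hτ)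
  · exact (min_le_right _ _).trans (Real.rpow_le_rpow_of_nonpos hε0 hε.2 hτ)

/-- Subtracting a suitable multiple of a monomial makes one vanishing moment dispensable. -/
theorem ConvergesOnMoments.exists_sub_moment {N : ℕ} (hL : IsSlowlyVaryingAtZero L A)
    (hαN : α ≠ N) (hε₁ : 0 < ε₁)
    (hlow : ∀ δ ∈ Set.Ioc 0 ε₁, ∃ c : ℝ, 0 < c ∧ ∀ ε ∈ Set.Icc δ ε₁, c ≤ L ε)
    (hscale : ∀ a ε : ℝ, 0 < a → 0 < ε → ∀ ψ, T (a * ε) ψ = T ε (schwartzDilate a ψ))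
    (hbd : ∀ ψ, ∀ δ ∈ Set.Ioc 0 ε₁, ∃ M : ℝ, ∀ ε ∈ Set.Icc δ ε₁, ‖T ε ψ‖ ≤ M)
    (hT : ConvergesOnMoments T α L (N + 1)) :
    ∃ c : ℂ, (α < N → c = 0) ∧
      ConvergesOnMoments (fun ε => T ε - (c * (ε : ℂ) ^ N) • schwartzMoment N) α L N := by
  obtain ⟨ρ, hρ0, hρ1⟩ := exists_moment_dual N
  have hw : ∀ ε : ℝ, 0 < ε → (ε : ℂ) ^ N * ((ε ^ (α - N) * L ε : ℝ) : ℂ) =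
      ((ε ^ α * L ε : ℝ) : ℂ) := by
    intro ε hε
    rw [← Complex.ofReal_pow, ← Complex.ofReal_mul, ← mul_assoc, ← Real.rpow_natCast,
      ← Real.rpow_add hε]
    congr 3
    ring
  obtain ⟨c, hc0, l, hl⟩ := exists_limit_of_increments (v := fun ε => ε ^ (α - N) * L ε)
    (G := fun ε => T ε ρ / (ε : ℂ) ^ N) (τ := α - N) (sub_ne_zero.2 hαN) hε₁
    (rpow_mul_bounded_below (α - N) hlow)
    (by
      intro δ hδ
      obtain ⟨M, hM⟩ := hbd ρ δ hδ
      refine ⟨M / δ ^ N, fun ε hε => ?_⟩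
      have hε0 : 0 < ε := hδ.1.trans_le hε.1
      rw [norm_div, norm_pow, Complex.norm_real, Real.norm_of_nonneg hε0.le]
      have hδ0 := hδ.1
      have hM0 := (norm_nonneg _).trans (hM ε hε)
      have hle := hM ε hε
      have hle2 := hε.1
      gcongr)
    (fun a ha => hL.tendsto_rpow_mul_ratio (α - N) ha)
    (by
      intro a ha
      have ha' : (a : ℂ) ≠ 0 := by exact_mod_cast ha.ne'
      -- The factor a^(-N) cancels the N-th moment of the dilate against that of ρ; evaluating T on
      -- this function gives ε^N times the increment G(aε) − G(ε).
      obtain ⟨l, hl⟩ := hT (((a : ℂ) ^ N)⁻¹ • schwartzDilate a ρ - ρ) (by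
        intro k hk
        rw [map_sub, map_smul, schwartzMoment_dilate ha, smul_eq_mul]
        rcases Nat.lt_succ_iff_lt_or_eq.1 hk with h | rfl
        · rw [hρ0 k h, mul_zero, mul_zero, sub_zero]
        · rw [hρ1]
          push_cast
          field_simp
          ring)
      refine ⟨l, hl.congr' ?_⟩
      filter_upwards [self_mem_nhdsWithin] with ε hε
      have hε' : (ε : ℂ) ≠ 0 := by exact_mod_cast (ne_of_gt hε)
      rw [hscale a ε ha hε, map_sub, map_smul, smul_eq_mul, ← hw ε hε]
      push_cast
      rw [mul_pow, ← div_div]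
      congr 1
      field_simp)
  refine ⟨c, fun h => hc0 (sub_neg.2 h), fun ψ hψ => ?_⟩
  -- ψ splits into a function with one more vanishing moment and a multiple of ρ, whose behaviour is
  -- now known.
  obtain ⟨l', hl'⟩ := hT (ψ - schwartzMoment N ψ • ρ) (by
    intro k hk
    rw [map_sub, map_smul, smul_eq_mul]
    rcases Nat.lt_succ_iff_lt_or_eq.1 hk with h | rfl
    · rw [hψ k h, hρ0 k h, mul_zero, sub_zero]
    · rw [hρ1, mul_one, sub_self])
  refine ⟨l' + schwartzMoment N ψ * l, (hl'.add (hl.const_mul _)).congr' ?_⟩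
  filter_upwards [self_mem_nhdsWithin] with ε hε
  have hε' : (ε : ℂ) ^ N ≠ 0 := pow_ne_zero _ (by exact_mod_cast (ne_of_gt hε))
  have h1 : (T ε ρ / (ε : ℂ) ^ N - c) / ((ε ^ (α - N) * L ε : ℝ) : ℂ) =
      (T ε ρ - c * (ε : ℂ) ^ N) / ((ε ^ α * L ε : ℝ) : ℂ) := by
    rw [← hw ε hε, ← div_div]
    congr 1
    field_simp
  rw [h1, map_sub, map_smul, smul_eq_mul, ← mul_div_assoc, ← add_div]
  congr 1
  change _ = T ε ψ - (c * (ε : ℂ) ^ N) • schwartzMoment N ψ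
  rw [smul_eq_mul]
  ring

/-- Convergence on functions with vanishing moments extends to all test functions, after
subtraction of a polynomial with exponents less than `α`. -/
theorem ConvergesOnMoments.exists_sub_polynomial {N : ℕ} (hL : IsSlowlyVaryingAtZero L A)
    (hα : ∀ k : ℕ, α ≠ k) (hε₁ : 0 < ε₁)
    (hlow : ∀ δ ∈ Set.Ioc 0 ε₁, ∃ c : ℝ, 0 < c ∧ ∀ ε ∈ Set.Icc δ ε₁, c ≤ L ε)
    (hscale : ∀ a ε : ℝ, 0 < a → 0 < ε → ∀ ψ, T (a * ε) ψ = T ε (schwartzDilate a ψ))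
    (hbd : ∀ ψ, ∀ δ ∈ Set.Ioc 0 ε₁, ∃ M : ℝ, ∀ ε ∈ Set.Icc δ ε₁, ‖T ε ψ‖ ≤ M)
    (hT : ConvergesOnMoments T α L N) :
    ∃ c : ℕ → ℂ, (∀ k : ℕ, α < k → c k = 0) ∧ ConvergesOnMoments
      (fun ε => T ε - ∑ k ∈ Finset.range N, (c k * (ε : ℂ) ^ k) • schwartzMoment k) α L 0 := by
  induction N generalizing T with
  | zero => exact ⟨0, fun _ _ => rfl, by simpa using hT⟩
  | succ N ih =>
    obtain ⟨b, hb, hT'⟩ := hT.exists_sub_moment hL (hα N) hε₁ hlow hscale hbd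
    -- The induction needs a family obeying the same scaling law; ε^N times the N-th moment obeys
    -- it, so the difference does.
    obtain ⟨c, hc, hT''⟩ := ih (T := fun ε => T ε - (b * (ε : ℂ) ^ N) • schwartzMoment N)
      (by
        intro a ε ha hε ψ
        change T (a * ε) ψ - (b * ((a * ε : ℝ) : ℂ) ^ N) • schwartzMoment N ψ =
          T ε (schwartzDilate a ψ) - (b * (ε : ℂ) ^ N) • schwartzMoment N (schwartzDilate a ψ)
        rw [hscale a ε ha hε, schwartzMoment_dilate ha, smul_eq_mul, smul_eq_mul]
        push_cast
        ring)
      (by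
        intro ψ δ hδ
        obtain ⟨M, hM⟩ := hbd ψ δ hδ
        refine ⟨M + ‖b‖ * ε₁ ^ N * ‖schwartzMoment N ψ‖, fun ε hε => ?_⟩
        have hε0 : 0 < ε := hδ.1.trans_le hε.1
        change ‖T ε ψ - (b * (ε : ℂ) ^ N) • schwartzMoment N ψ‖ ≤ _
        refine (norm_sub_le _ _).trans (add_le_add (hM ε hε) ?_)
        rw [norm_smul, norm_mul, norm_pow, Complex.norm_real, Real.norm_of_nonneg hε0.le]
        have := hε.2
        gcongr)
      hT'
    refine ⟨Function.update c N b, fun k hk => ?_, ?_⟩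
    · rcases eq_or_ne k N with rfl | h
      · rw [Function.update_self]; exact hb hk
      · rw [Function.update_of_ne h]; exact hc k hk
    · convert! hT'' using 2 with ε
      rw [Finset.sum_range_succ, Function.update_self, sub_sub, add_comm]
      congr 2
      refine Finset.sum_congr rfl fun k hk => ?_
      rw [Function.update_of_ne (Finset.mem_range.1 hk).ne]

end MomentReduction

/-! ### The two implications -/

variable {φ : 𝓢(ℝ, ℂ)} {f : 𝓢'(ℝ, ℂ)} {L : ℝ → ℝ} {A x₀ α ε₀ : ℝ}

theorem IsSlowlyVaryingAtZero.eventually_weight_pos (hL : IsSlowlyVaryingAtZero L A) (α : ℝ) :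
    ∀ᶠ ε in 𝓝[>] (0 : ℝ), 0 < ε ^ α * L ε := by
  filter_upwards [Ioc_mem_nhdsGT hL.A_pos] with ε hε
  exact mul_pos (Real.rpow_pos_of_pos hε.1 α) (hL.pos ε hε)

/-- The distribution `f(x₀ + ε ·)` as a continuous linear functional. -/
def affineFunctional (f : 𝓢'(ℝ, ℂ)) (x₀ ε : ℝ) : 𝓢(ℝ, ℂ) →L[ℂ] ℂ :=
  affineDistribution f x₀ ε

theorem affineFunctional_apply (f : 𝓢'(ℝ, ℂ)) (x₀ ε : ℝ) (ψ : 𝓢(ℝ, ℂ)) :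
    affineFunctional f x₀ ε ψ = affineDistribution f x₀ ε ψ := rfl

theorem exists_affineDistribution_apply_bound (f : 𝓢'(ℝ, ℂ)) (x₀ : ℝ) (ψ : 𝓢(ℝ, ℂ)) {δ : ℝ}
    (hδ : 0 < δ) (ε₀ : ℝ) :
    ∃ M : ℝ, ∀ ε ∈ Set.Icc δ ε₀, ‖affineDistribution f x₀ ε ψ‖ ≤ M := by
  obtain ⟨K, h⟩ := exists_affineDistribution_bound f x₀
  obtain ⟨C, -, hC⟩ := h δ ε₀ hδ
  exact ⟨_, fun ε hε => hC ε hε ψ⟩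

/-- Convergence and boundedness of the wavelet coefficients give convergence on test functions
with sufficiently many vanishing moments. -/
theorem exists_convergesOnMoments (hφ₀ : φ ∈ schwartzZero) (hφ : IsOrthonormalWavelet φ)
    (hL : IsSlowlyVaryingAtZero L A) (hε₀ : ε₀ ∈ Set.Ioc 0 A)
    (hlim : CoeffLimitsExist φ f x₀ α L) (hbound : CoeffBound φ f x₀ α L ε₀) :
    ∃ N, ConvergesOnMoments (affineFunctional f x₀) α L N := by
  obtain ⟨K, hK⟩ := exists_affineDistribution_bound f x₀
  obtain ⟨β, γ, C, hβ, hγ, hC, hb⟩ := hbound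
  -- The first entry makes the expansion of T_ε converge, the second beats the growth exponent γ
  -- with a summable factor to spare.
  set N := max (2 * K + 2) (⌈γ⌉₊ + 1)
  refine ⟨N + 1, fun ψ hψ => ?_⟩
  have hψ' : ∀ k ≤ N, schwartzMoment k ψ = 0 := fun k hk => hψ k (Nat.lt_succ_of_le hk)
  set a : ℤ × ℤ → ℂ := fun p => ∫ x : ℝ, ψ x * waveletFun φ p.1 p.2 x
  obtain ⟨D, hD, hdec⟩ := exists_waveletCoeff_decay hφ₀ ψ N (⌈β⌉₊ + 2) hψ'
  choose l hl using hlim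
  refine ⟨∑' p : ℤ × ℤ, a p * l p.1 p.2, ?_⟩
  have hsum : ∀ ε : ℝ, 0 < ε → affineDistribution f x₀ ε ψ / ((ε ^ α * L ε : ℝ) : ℂ) =
      ∑' p : ℤ × ℤ, a p * (waveletCoeff φ f x₀ p.1 p.2 ε / ((ε ^ α * L ε : ℝ) : ℂ)) := by
    intro ε hε
    -- The constant may depend on ε, since it only serves convergence at that ε; what matters is
    -- that K, hence N, does not.
    obtain ⟨C', -, hC'⟩ := hK ε ε hε
    have h := hasSum_wavelet_expansion hφ₀ hφ (le_max_left _ _ : 2 * K + 2 ≤ N)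
      (affineFunctional f x₀ ε) (hC' ε ⟨le_rfl, le_rfl⟩) hψ'
    rw [← affineFunctional_apply, ← (h.div_const _).tsum_eq]
    exact tsum_congr fun p => mul_div_assoc _ _ _
  have key := tendsto_tsum_of_dominated_convergence (𝓕 := 𝓝[>] (0 : ℝ))
    (f := fun ε (p : ℤ × ℤ) =>
      a p * (waveletCoeff φ f x₀ p.1 p.2 ε / ((ε ^ α * L ε : ℝ) : ℂ)))
    (g := fun p => a p * l p.1 p.2) (summable_wavelet_weight.mul_left (D * C))
    (fun p => (hl p.1 p.2).const_mul _) (by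
      filter_upwards [Ioc_mem_nhdsGT hε₀.1] with ε hε p
      have hw : 0 < ε ^ α * L ε :=
        mul_pos (Real.rpow_pos_of_pos hε.1 α) (hL.pos ε ⟨hε.1, hε.2.trans hε₀.2⟩)
      set κ := (2 : ℝ) ^ p.1 + 1 / (2 : ℝ) ^ p.1
      have hκ : 1 ≤ κ := one_le_add_inv (by positivity)
      have hκ0 : 0 < κ := one_pos.trans_le hκ
      have hn : 1 ≤ 1 + |(p.2 : ℝ)| := le_add_of_nonneg_right (abs_nonneg _)
      have hn0 : 0 < 1 + |(p.2 : ℝ)| := one_pos.trans_le hn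
      have h1 : (1 + |(p.2 : ℝ)|) ^ β ≤ (1 + |(p.2 : ℝ)|) ^ ⌈β⌉₊ := by
        rw [← Real.rpow_natCast]
        exact Real.rpow_le_rpow_of_exponent_le hn (Nat.le_ceil β)
      have h2 : κ ^ γ ≤ κ ^ ⌈γ⌉₊ := by
        rw [← Real.rpow_natCast]
        exact Real.rpow_le_rpow_of_exponent_le hκ (Nat.le_ceil γ)
      have h3 : ‖waveletCoeff φ f x₀ p.1 p.2 ε / ((ε ^ α * L ε : ℝ) : ℂ)‖ ≤
          C * (1 + |(p.2 : ℝ)|) ^ ⌈β⌉₊ * κ ^ ⌈γ⌉₊ := by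
        rw [norm_div, Complex.norm_real, Real.norm_of_nonneg hw.le, div_le_iff₀ hw]
        calc _ ≤ _ := hb p.1 p.2 ε hε.1 hε.2
          _ ≤ C * (ε ^ α * L ε) * (1 + |(p.2 : ℝ)|) ^ ⌈β⌉₊ * κ ^ ⌈γ⌉₊ := by gcongr
          _ = _ := by ring
      have h4 : (κ ^ N)⁻¹ ≤ (κ ^ (⌈γ⌉₊ + 1))⁻¹ :=
        inv_anti₀ (by positivity) (pow_le_pow_right₀ hκ (le_max_right _ _))
      rw [norm_mul]
      calc _ ≤ (D * (κ ^ (⌈γ⌉₊ + 1))⁻¹ * ((1 + |(p.2 : ℝ)|) ^ (⌈β⌉₊ + 2))⁻¹) *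
            (C * (1 + |(p.2 : ℝ)|) ^ ⌈β⌉₊ * κ ^ ⌈γ⌉₊) :=
            mul_le_mul ((hdec p.1 p.2).trans (by gcongr)) h3 (norm_nonneg _) (by positivity)
        _ = _ := by
            rw [pow_succ κ, pow_add _ _ 2]
            field_simp)
  refine key.congr' ?_
  filter_upwards [self_mem_nhdsWithin] with ε hε
  exact (hsum ε hε).symm

theorem hasExpansion_iff_tendsto (hL : IsSlowlyVaryingAtZero L A) (p : Polynomial ℂ)
    (g : 𝓢'(ℝ, ℂ)) : HasExpansion f x₀ α L p g ↔ ∀ ψ : 𝓢(ℝ, ℂ), Tendsto (fun ε : ℝ =>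
      (affineDistribution f x₀ ε ψ - ∫ x : ℝ, p.eval ((ε * x : ℝ) : ℂ) * ψ x) /
        ((ε ^ α * L ε : ℝ) : ℂ)) (𝓝[>] 0) (𝓝 (g ψ)) := by
  have hev := hL.eventually_weight_pos α
  refine forall_congr' fun ψ => ?_
  rw [← isLittleO_norm_right]
  have h1 : (fun ε : ℝ => ‖ε ^ α * L ε‖) = fun ε : ℝ => ‖((ε ^ α * L ε : ℝ) : ℂ)‖ := by
    funext ε
    rw [Complex.norm_real]
  rw [h1, isLittleO_norm_right, isLittleO_iff_tendsto']
  · refine Iff.trans (tendsto_congr' ?_) tendsto_sub_nhds_zero_iff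
    filter_upwards [hev] with ε hε
    have hne : ((ε ^ α * L ε : ℝ) : ℂ) ≠ 0 := by exact_mod_cast hε.ne'
    rw [sub_div, mul_div_cancel_left₀ _ hne]
  · filter_upwards [hev] with ε hε h0
    exact absurd h0 (by exact_mod_cast hε.ne')

theorem expansionExists_of_convergesOnMoments (hL : IsSlowlyVaryingAtZero L A) (hα : 0 < α)
    (hα' : ∀ k : ℕ, α ≠ k) {N : ℕ}
    (hT : ConvergesOnMoments (affineFunctional f x₀) α L N) :
    ExpansionExists f x₀ α L := by
  obtain ⟨ε₁, hε₁, hlow⟩ := hL.exists_bounded_below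
  obtain ⟨c, hc, hconv⟩ := hT.exists_sub_polynomial (T := affineFunctional f x₀) hL hα' hε₁.1 hlow
    (fun a ε ha hε ψ => affineDistribution_mul f x₀ ha hε ψ)
    (fun ψ δ hδ => exists_affineDistribution_apply_bound f x₀ ψ hδ.1 ε₁)
  let p : Polynomial ℂ := ∑ k ∈ Finset.range N, Polynomial.monomial k (c k)
  have hcoeff : ∀ k, p.coeff k = if k ∈ Finset.range N then c k else 0 := by
    intro k
    simp only [p, Polynomial.finsetSum_coeff, Polynomial.coeff_monomial, Finset.sum_ite_eq']
  have hdegα : (p.natDegree : ℝ) < α := by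
    by_contra! h
    have h' := lt_of_le_of_ne h (hα' p.natDegree)
    have hp : p ≠ 0 := by
      rintro hp
      rw [hp, Polynomial.natDegree_zero, Nat.cast_zero] at h'
      exact h'.not_gt hα
    have h2 := Polynomial.leadingCoeff_ne_zero.2 hp
    rw [Polynomial.leadingCoeff, hcoeff, hc _ h', ite_self] at h2
    exact h2 rfl
  have hpoly : ∀ (ε : ℝ) ψ, ∫ x : ℝ, p.eval ((ε * x : ℝ) : ℂ) * ψ x =
      ∑ k ∈ Finset.range N, c k * (ε : ℂ) ^ k * schwartzMoment k ψ := by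
    intro ε ψ
    rw [integral_polynomial_eq_sum p
      (lt_of_lt_of_le (Nat.lt_succ_self _) (le_max_right N (p.natDegree + 1)))]
    symm
    refine Finset.sum_subset_zero_on_sdiff (Finset.range_subset_range.2 (le_max_left _ _)) ?_ ?_
    · intro k hk
      rw [hcoeff, if_neg (Finset.mem_sdiff.1 hk).2, zero_mul, zero_mul]
    · intro k hk
      rw [hcoeff, if_pos hk]
  obtain ⟨g, hg⟩ := exists_distribution_of_tendsto
    (fun ε => ((ε ^ α * L ε : ℝ) : ℂ)⁻¹ • (affineFunctional f x₀ ε -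
      ∑ k ∈ Finset.range N, (c k * (ε : ℂ) ^ k) • schwartzMoment k)) (fun ψ => by
      obtain ⟨l, hl⟩ := hconv ψ (by simp)
      refine ⟨l, hl.congr fun ε => ?_⟩
      rw [_root_.smul_apply, smul_eq_mul, div_eq_inv_mul])
  have hlim : ∀ ψ : 𝓢(ℝ, ℂ), Tendsto (fun ε : ℝ =>
      (affineDistribution f x₀ ε ψ - ∫ x : ℝ, p.eval ((ε * x : ℝ) : ℂ) * ψ x) /
        ((ε ^ α * L ε : ℝ) : ℂ)) (𝓝[>] 0) (𝓝 (g ψ)) := by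
    intro ψ
    refine (hg ψ).congr fun ε => ?_
    rw [hpoly, div_eq_inv_mul, _root_.smul_apply, smul_eq_mul, _root_.sub_apply,
      _root_.sum_apply]
    rfl
  refine ⟨p, g, hdegα, fun a ha => ?_, (hasExpansion_iff_tendsto hL p g).2 hlim⟩
  ext ψ
  rw [affineDistribution_zero_apply g ha]
  change _ = ((a ^ α : ℝ) : ℂ) * g ψ
  -- Homogeneity: the limit at aε equals a^α g(ψ) after renormalizing by w(ε), and it is also the
  -- limit at ε tested on the dilate of ψ.
  have h1 := (hlim ψ).comp (tendsto_const_mul_nhdsGT_zero ha)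
  have h2 := ((Complex.continuous_ofReal.tendsto _).comp
    (hL.tendsto_rpow_mul_ratio α ha)).mul h1
  refine tendsto_nhds_unique (hlim (schwartzDilate a ψ)) (h2.congr' ?_)
  have hev := hL.eventually_weight_pos α
  filter_upwards [hev, (tendsto_const_mul_nhdsGT_zero ha).eventually hev, self_mem_nhdsWithin]
    with ε hε hε' hpos
  have hne : (((a * ε) ^ α * L (a * ε) : ℝ) : ℂ) ≠ 0 := by exact_mod_cast hε'.ne'
  simp only [Function.comp_apply]
  rw [← affineDistribution_mul f x₀ ha hpos, hpoly, hpoly, Complex.ofReal_div, mul_comm,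
    div_mul_div_cancel₀ hne]
  congr 2
  refine Finset.sum_congr rfl fun k _ => ?_
  rw [schwartzMoment_dilate ha]
  push_cast
  ring

theorem coeffLimitsExist_of_expansionExists (hφ₀ : φ ∈ schwartzZero)
    (hL : IsSlowlyVaryingAtZero L A) (h : ExpansionExists f x₀ α L) :
    CoeffLimitsExist φ f x₀ α L := by
  obtain ⟨p, g, -, -, hexp⟩ := h
  intro m n
  have := (hasExpansion_iff_tendsto hL p g).1 hexp (schwartzConj (waveletFun φ m n))
  refine ⟨_, this.congr fun ε => ?_⟩
  rw [integral_polynomial_eq_sum p (Nat.lt_succ_self _),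
    Finset.sum_eq_zero fun k _ => by rw [schwartzMoment_conj_waveletFun hφ₀, mul_zero], sub_zero]
  rfl

/-- The bound must hold up to ε₀, where the expansion says nothing. There w is bounded below and T_ε
is locally bounded in ε, so Banach–Steinhaus applies to the whole range (0,ε₀]. -/
theorem coeffBound_of_expansionExists (hφ₀ : φ ∈ schwartzZero)
    (hL : IsSlowlyVaryingAtZero L A) (hε₀ : ε₀ ∈ Set.Ioc 0 A)
    (hlow : ∀ δ ∈ Set.Ioc 0 ε₀, ∃ c : ℝ, 0 < c ∧ ∀ ε ∈ Set.Icc δ ε₀, c ≤ L ε)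
    (h : ExpansionExists f x₀ α L) : CoeffBound φ f x₀ α L ε₀ := by
  obtain ⟨p, g, -, -, hexp⟩ := h
  have hlim := (hasExpansion_iff_tendsto hL p g).1 hexp
  have hw : ∀ ε ∈ Set.Ioc 0 ε₀, 0 < ε ^ α * L ε := fun ε hε =>
    mul_pos (Real.rpow_pos_of_pos hε.1 α) (hL.pos ε ⟨hε.1, hε.2.trans hε₀.2⟩)
  set N := p.natDegree + 1
  let P : ℝ → 𝓢(ℝ, ℂ) →L[ℂ] ℂ := fun ε =>
    ∑ k ∈ Finset.range N, (p.coeff k * (ε : ℂ) ^ k) • schwartzMoment k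
  have hP : ∀ (ε : ℝ) ψ, P ε ψ = ∑ k ∈ Finset.range N,
      p.coeff k * (ε : ℂ) ^ k * schwartzMoment k ψ := by
    intro ε ψ
    simp only [P]
    rw [_root_.sum_apply]
    rfl
  let U : Set.Ioc 0 ε₀ → 𝓢(ℝ, ℂ) →L[ℂ] ℂ := fun ε =>
    (((ε : ℝ) ^ α * L ε : ℝ) : ℂ)⁻¹ • (affineFunctional f x₀ ε - P ε)
  have hU : ∀ (ε : Set.Ioc 0 ε₀) ψ, U ε ψ =
      (affineDistribution f x₀ ε ψ - P ε ψ) / (((ε : ℝ) ^ α * L ε : ℝ) : ℂ) := by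
    intro ε ψ
    rw [div_eq_inv_mul]
    rfl
  have hUbd : ∀ ψ, ∃ M, ∀ ε, ‖U ε ψ‖ ≤ M := by
    intro ψ
    have h1 := (hlim ψ).norm.eventually (eventually_lt_nhds (lt_add_one _))
    obtain ⟨ε₂, hε₂, hsub⟩ := mem_nhdsGT_iff_exists_Ioc_subset.1 h1
    set δ := min ε₂ ε₀
    have hδ : δ ∈ Set.Ioc 0 ε₀ := ⟨lt_min hε₂ hε₀.1, min_le_right _ _⟩
    obtain ⟨M, hM⟩ := exists_affineDistribution_apply_bound f x₀ ψ hδ.1 ε₀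
    obtain ⟨c, hc, hcw⟩ := rpow_mul_bounded_below α hlow δ hδ
    set Q := ∑ k ∈ Finset.range N, ‖p.coeff k‖ * ε₀ ^ k * ‖schwartzMoment k ψ‖
    refine ⟨max (‖g ψ‖ + 1) ((M + Q) / c), fun ε => ?_⟩
    rw [hU]
    rcases le_total (ε : ℝ) δ with hle | hle
    · have h2 := hsub ⟨ε.2.1, hle.trans (min_le_left _ _)⟩
      refine le_trans ?_ (le_max_left _ _)
      rw [hP, ← integral_polynomial_eq_sum p (Nat.lt_succ_self _)]
      exact le_of_lt h2
    · have hI : (ε : ℝ) ∈ Set.Icc δ ε₀ := ⟨hle, ε.2.2⟩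
      refine le_trans ?_ (le_max_right _ _)
      have hε0 : 0 < (ε : ℝ) := ε.2.1
      have hQ : ‖P ε ψ‖ ≤ Q := by
        rw [hP]
        refine (norm_sum_le _ _).trans (Finset.sum_le_sum fun k _ => ?_)
        rw [norm_mul, norm_mul, norm_pow, Complex.norm_real, Real.norm_of_nonneg hε0.le]
        have := ε.2.2
        gcongr
      rw [norm_div, Complex.norm_real, Real.norm_of_nonneg (hw ε ε.2).le]
      have h3 := (norm_sub_le _ _).trans (add_le_add (hM ε hI) hQ)
      exact div_le_div₀ ((norm_nonneg _).trans h3) h3 hc (hcw ε hI)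
  obtain ⟨K, C, hC, hUK⟩ := exists_uniform_schwartzSup_bound U hUbd
  set S := schwartzSup K (schwartzConj φ)
  have hS : 0 ≤ S := apply_nonneg _ _
  -- The exponent K + 1 and the summand 1 only secure strict positivity, as K or the seminorm of φ
  -- may be 0.
  refine ⟨(K + 1 : ℕ), (2 * K + 1 : ℕ), C * (2 ^ K * S) + 1, by positivity, by positivity,
    by positivity, fun m n ε hε hε' => ?_⟩
  have hwε := hw ε ⟨hε, hε'⟩
  set κ := (2 : ℝ) ^ m + 1 / (2 : ℝ) ^ m
  have hκ0 : 0 < κ := by positivity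
  rw [Real.rpow_natCast, Real.rpow_natCast]
  have h1 := hUK (⟨ε, hε, hε'⟩ : Set.Ioc 0 ε₀) (schwartzConj (waveletFun φ m n))
  have hP0 : P ε (schwartzConj (waveletFun φ m n)) = 0 := by
    rw [hP]
    exact Finset.sum_eq_zero fun k _ => by rw [schwartzMoment_conj_waveletFun hφ₀, mul_zero]
  rw [hU, hP0, sub_zero, norm_div, Complex.norm_real, Real.norm_of_nonneg hwε.le,
    div_le_iff₀ hwε, schwartzConj_waveletFun] at h1
  rw [waveletCoeff, schwartzConj_waveletFun]
  refine h1.trans ?_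
  have h2 := schwartzSup_waveletFun_le K (schwartzConj φ) m n
  have h3 : (1 + |(n : ℝ)|) ^ K ≤ (1 + |(n : ℝ)|) ^ (K + 1) :=
    pow_le_pow_right₀ (le_add_of_nonneg_right (abs_nonneg _)) (Nat.le_succ K)
  calc C * schwartzSup K (waveletFun (schwartzConj φ) m n) * (ε ^ α * L ε)
      ≤ C * (κ ^ (2 * K + 1) * (1 + |(n : ℝ)|) ^ (K + 1) * (2 ^ K * S)) * (ε ^ α * L ε) := by
        gcongr
        exact h2.trans (by gcongr)
    _ = C * (2 ^ K * S) * (ε ^ α * L ε) * (1 + |(n : ℝ)|) ^ (K + 1) * κ ^ (2 * K + 1) := by ring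
    _ ≤ _ := by
        gcongr
        exact le_add_of_nonneg_right zero_le_one

end

theorem theorem5p3 (φ : 𝓢(ℝ, ℂ)) (hφ₀ : φ ∈ schwartzZero) (hφ : IsOrthonormalWavelet φ)
    (L : ℝ → ℝ) (A : ℝ) (hL : IsSlowlyVaryingAtZero L A)
    (f : 𝓢'(ℝ, ℂ)) (x₀ α : ℝ) (hα : 0 < α) (hα' : ∀ k : ℕ, α ≠ k) :
    ((CoeffLimitsExist φ f x₀ α L ∧ ∃ ε₀ ∈ Set.Ioc 0 A, CoeffBound φ f x₀ α L ε₀) ↔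
        ExpansionExists f x₀ α L) ∧
      ∀ ε₀ ∈ Set.Ioc 0 A,
        (∀ δ ∈ Set.Ioc 0 ε₀, ∃ c : ℝ, 0 < c ∧ ∀ ε ∈ Set.Icc δ ε₀, c ≤ L ε) →
        ((CoeffLimitsExist φ f x₀ α L ∧ CoeffBound φ f x₀ α L ε₀) ↔
          ExpansionExists f x₀ α L) := by
  have tauberian : ∀ ε₀ ∈ Set.Ioc 0 A, CoeffLimitsExist φ f x₀ α L → CoeffBound φ f x₀ α L ε₀ →
      ExpansionExists f x₀ α L := fun ε₀ hε₀ hlim hb => by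
    obtain ⟨N, hN⟩ := exists_convergesOnMoments hφ₀ hφ hL hε₀ hlim hb
    exact expansionExists_of_convergesOnMoments hL hα hα' hN
  refine ⟨⟨fun ⟨hlim, ε₀, hε₀, hb⟩ => tauberian ε₀ hε₀ hlim hb, fun h => ?_⟩,
    fun ε₀ hε₀ hlow => ⟨fun ⟨hlim, hb⟩ => tauberian ε₀ hε₀ hlim hb, fun h => ?_⟩⟩
  · obtain ⟨ε₁, hε₁, hlow⟩ := hL.exists_bounded_below
    exact ⟨coeffLimitsExist_of_expansionExists hφ₀ hL h, ε₁, hε₁,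
      coeffBound_of_expansionExists hφ₀ hL hε₁ hlow h⟩
  · exact ⟨coeffLimitsExist_of_expansionExists hφ₀ hL h,
      coeffBound_of_expansionExists hφ₀ hL hε₀ hlow h⟩
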